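/- Let $d\in\mathbb N$, $L>0$, $\mathbb T^d=\mathbb R^d/(L\mathbb Z)^d$, and let $L^2_S(\mathbb T^d)$ be the space of real $u\in L^2(\mathbb T^d)$ that are even in each coordinate, $L^2_{ex}(\mathbb T^d)$ the subspace of those $u\in L^2_S(\mathbb T^d)$ that are moreover invariant under permutations of the coordinates. For $k\in\mathbb N^d$ ($0\in\mathbb N$) put $$\Theta(k)=\prod_{i=1}^d\sqrt{2-\delta_{k_i,0}},\qquad \omega_k(x)=\frac{\Theta(k)}{L^{d/2}}\prod_{i=1}^d\cos\Big(\frac{2\pi k_i}{L}x_i\Big).$$ Let $W\in L^2_S(\mathbb T^d)$, $\tilde W(k)=\int_{\mathbb T^d} W\omega_k\,dx$, $W_0=\int_{\mathbb T^d} W\,dx<0$, $B>0$, and let $\Phi:\mathbb R\to\mathbb R$ be continuous, $C^1$ on $\mathbb R\setminus\{0\}$, increasing (possibly not strictly) on $[0,\infty)$ and zero on $(-\infty,0]$. For $\kappa>0$ define $$\bar{\mathcal G}(\bar\rho,\kappa)=\bar\rho-\frac{\int_0^\infty s\,e^{-\kappa(s-\Phi_{\bar\rho})^2/2}\,ds}{L^d\int_0^\infty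 e^{-\kappa(s-\Phi_{\bar\rho})^2/2}\,ds},\qquad \Phi_{\bar\rho}=\Phi(W*\bar\rho+B),$$ where $*$ is convolution on $\mathbb T^d$. Then for every $\kappa>0$ there is exactly one constant $\bar\rho_\infty^\kappa$ with $\bar{\mathcal G}(\bar\rho_\infty^\kappa,\kappa)=0$. Now fix $\kappa>\frac{2|W_0|^2}{L^{2d}\pi B^2}$, write $y_0=W_0\bar\rho_\infty^\kappa+B$, $\Phi_0=\Phi(y_0)$, $\Phi_0'=\Phi'(y_0)$, $\Phi_0''=\Phi''(y_0)$, and assume that $\Phi$ is $C^2$ in a neighbourhood of $y_0$, $\Phi_0'\neq0$ and $\Phi_0''\ge0$. For $k\in\mathbb N^d$ consider the equation $$\frac{\tilde W(k)}{\Theta(k)}=\frac{1}{L^{d/2}\,\Phi_0'\left(\frac1{L^d}-L^d\bar\rho_\infty^\kappa\left(\bar\rho_\infty^\kappa-\frac{\Phi_0}{L^d}\right)\kappa\right)}.\tag{1}$$ Assume one of the following, for some $k^*\in\mathbb N^d$: (i) $k^*$ is the only $k\in\mathbb N^d$ satisfying (1); put $V=L^2_S(\mathbb T^d)$ and $\omega=\omega_{k^*}$;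 (ii) $W$ is invariant under permutations of the coordinates and the $k\in\mathbb N^d$ satisfying (1) are exactly the elements of the set $[k^*]$ of permutations of $k^*$; put $V=L^2_{ex}(\mathbb T^d)$ and $\omega=\operatorname{card}([k^*])^{-1/2}\sum_{l\in[k^*]}\omega_l$. Then $(\bar\rho_\infty^\kappa,\kappa)$ is a bifurcation point of $\bar{\mathcal G}(\bar\rho,\kappa)=0$ in $L^2_S(\mathbb T^d)$: it is a solution, and each of its neighbourhoods in $L^2_S(\mathbb T^d)\times(0,\infty)$ contains solutions that are not on the homogeneous branch $\{(\bar\rho_\infty^{\kappa'},\kappa'):\kappa'>0\}$. Moreover there are $\delta>0$ and a $C^1$ curve $z\mapsto(\bar\rho_{\kappa(z)},\kappa(z))\in V\times(0,\infty)$, $z\in(-\delta,\delta)$, of solutions of $\bar{\mathcal G}=0$, equal to $(\bar\rho_\infty^\kappa,\kappa)$ at $z=0$ and with $\bar\rho_{\kappa(z)}$ not constant for $z\ne0$, such that $$\bar\rho_{\kappa(z)}=\bar\rho_\infty^{\kappa(z)}+z\,\omega+o(z)\qquad(z\to0)$$ both in $L^2(\mathbb T^d)$ and uniformly (a.e.)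 in $x\in\mathbb T^d$; and there are a neighbourhood $U$ of $\bar\rho_\infty^\kappa$ in $V$ and $\varepsilon\in(0,\kappa]$ such that every solution $(\bar\rho,\kappa')\in U\times(\kappa-\varepsilon,\kappa+\varepsilon)$ of $\bar{\mathcal G}(\bar\rho,\kappa')=0$ lies either on the homogeneous branch or on this curve. -/

import Mathlib

open MeasureTheory Set Filter Topology Asymptotics

noncomputable section

namespace NeuralField

/-- The torus `(ℝ / L ℤ)^d`; its `volume` is the Lebesgue measure, of total mass `L ^ d`. -/
abbrev Torus (d : ℕ) (L : ℝ) : Type := Fin d → AddCircle L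

/-- The real Hilbert space `L²` of the torus. -/
abbrev L2 (d : ℕ) (L : ℝ) [Fact (0 < L)] : Type :=
  Lp ℝ 2 (volume : Measure (Torus d L))

variable {d : ℕ} {L : ℝ} [Fact (0 < L)]

/-- `u` is even in each coordinate, i.e. `u` lies in `L²_S`. -/
def IsCoordEven (u : L2 d L) : Prop :=
  ∀ i : Fin d, (fun x : Torus d L => u (Function.update x i (-x i))) =ᵐ[volume] u

/-- `u` is invariant under all permutations of the coordinates. -/
def IsPermInvariant (u : L2 d L) : Prop :=
  ∀ ζ : Equiv.Perm (Fin d), (fun x : Torus d L => u (fun i => x (ζ i))) =ᵐ[volume] u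

/-- The space `L²_S` of coordinate-wise even functions. -/
def L2S (d : ℕ) (L : ℝ) [Fact (0 < L)] : Set (L2 d L) := {u | IsCoordEven u}

/-- The space `L²_ex` of coordinate-wise even functions with exchangeable coordinates. -/
def L2ex (d : ℕ) (L : ℝ) [Fact (0 < L)] : Set (L2 d L) :=
  {u | IsCoordEven u ∧ IsPermInvariant u}

/-- The constant function `c` as an element of `L²`. -/
def constL2 (d : ℕ) (L : ℝ) [Fact (0 < L)] (c : ℝ) : L2 d L := Lp.const 2 volume c

/-! ### The Fourier basis -/

/-- The one-dimensional mode `x ↦ cos (2 π n x / L)` on `ℝ / L ℤ` (the constant `1` for `n = 0`),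
see `cosMode_coe`. -/
def cosMode (n : ℕ) (x : AddCircle L) : ℝ := (fourier (n : ℤ) x).re

theorem cosMode_coe (L : ℝ) (n : ℕ) (t : ℝ) :
    cosMode n (t : AddCircle L) = Real.cos (2 * Real.pi * n / L * t) := by
  have h : (2 * (Real.pi : ℂ) * Complex.I * ((n : ℤ) : ℂ) * t / L : ℂ) =
      ((2 * Real.pi * n / L * t : ℝ) : ℂ) * Complex.I := by
    push_cast
    ring
  rw [cosMode, fourier_coe_apply, h, Complex.exp_ofReal_mul_I_re]

/-- `Θ(k) = ∏ i, √(2 - δ_{k i, 0})`. -/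
def Theta (k : Fin d → ℕ) : ℝ := ∏ i, √(2 - if k i = 0 then 1 else 0)

/-- The basis function `ω_k`, as a continuous function on the torus. -/
def omega (L : ℝ) [Fact (0 < L)] (k : Fin d → ℕ) : C(Torus d L, ℝ) where
  toFun x := Theta k / L ^ ((d : ℝ) / 2) * ∏ i, cosMode (k i) (x i)
  continuous_toFun := by
    unfold cosMode
    fun_prop

/-- The set `[k]` of all permutations of the multi-index `k`. -/
def permClass (k : Fin d → ℕ) : Finset (Fin d → ℕ) :=
  Finset.univ.image fun ζ : Equiv.Perm (Fin d) => fun i => k (ζ i)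

/-- The normalised symmetrised mode `ω_[k] = card([k])^(-1/2) ∑_{l ∈ [k]} ω_l`. -/
def omegaSym (L : ℝ) [Fact (0 < L)] (k : Fin d → ℕ) : C(Torus d L, ℝ) :=
  (1 / √((permClass k).card : ℝ)) • ∑ l ∈ permClass k, omega L l

/-- A continuous function on the torus as an element of `L²`. -/
def toL2 (f : C(Torus d L, ℝ)) : L2 d L := ContinuousMap.toLp 2 volume ℝ f

/-- The Fourier mode `W̃(k) = ⟨W, ω_k⟩`. -/
def fourierMode (W : L2 d L) (k : Fin d → ℕ) : ℝ := ∫ x, W x * omega L k x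

/-- The total integral `W₀` of `W`. -/
def totalIntegral (W : L2 d L) : ℝ := ∫ x, W x

/-! ### The stationary-mean functional -/

/-- The convolution `W * u` on the torus. -/
def conv (W : L2 d L) (u : Torus d L → ℝ) (x : Torus d L) : ℝ := ∫ y, W (x - y) * u y

/-- The stationary-mean functional `Ḡ(u, κ)`, as a function on the torus. -/
def meanFunctional (Φ : ℝ → ℝ) (W : L2 d L) (B : ℝ) (u : Torus d L → ℝ) (κ : ℝ)
    (x : Torus d L) : ℝ :=
  u x - (1 / (L ^ d * ∫ s in Ioi (0 : ℝ), Real.exp (-κ * (s - Φ (conv W u x + B)) ^ 2 / 2))) *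
    ∫ s in Ioi (0 : ℝ), s * Real.exp (-κ * (s - Φ (conv W u x + B)) ^ 2 / 2)

/-- `Ḡ(u, κ) = 0` as an element of `L²`. -/
def IsStationaryMean (Φ : ℝ → ℝ) (W : L2 d L) (B : ℝ) (u : L2 d L) (κ : ℝ) : Prop :=
  meanFunctional Φ W B u κ =ᵐ[volume] 0

/-- The mean `ρ̄∞^κ` of the spatially homogeneous stationary state: the constant solution of
`Ḡ(·, κ) = 0`. The main theorem contains the claim that there is exactly one. -/
def rhoInf (Φ : ℝ → ℝ) (W : L2 d L) (B κ : ℝ) : ℝ :=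
  Classical.epsilon fun r : ℝ => IsStationaryMean Φ W B (constL2 d L r) κ

/-- The homogeneous input `W₀ ρ̄∞^κ + B`. -/
def homInput (Φ : ℝ → ℝ) (W : L2 d L) (B κ : ℝ) : ℝ :=
  totalIntegral W * rhoInf Φ W B κ + B

/-- The standing assumption on `Φ`, `W₀` and `B`. -/
structure StandingAssumption (Φ : ℝ → ℝ) (W : L2 d L) (B : ℝ) : Prop where
  continuous : Continuous Φ
  contDiffOn : ContDiffOn ℝ 1 Φ {0}ᶜ
  monotoneOn : MonotoneOn Φ (Ici 0)
  eq_zero : ∀ x ≤ 0, Φ x = 0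
  input_pos : 0 < B
  integral_neg : totalIntegral W < 0

/-- The equation
`W̃(k) / Θ(k) = 1 / (L^{d/2} Φ₀' (L^{-d} - L^d ρ̄∞ (ρ̄∞ - Φ₀ / L^d) κ))` for the mode `k`. -/
def ModeCondition (Φ : ℝ → ℝ) (W : L2 d L) (B κ : ℝ) (k : Fin d → ℕ) : Prop :=
  fourierMode W k / Theta k =
    1 / (L ^ ((d : ℝ) / 2) * deriv Φ (homInput Φ W B κ) *
      (1 / L ^ d - L ^ d * rhoInf Φ W B κ *
        (rhoInf Φ W B κ - Φ (homInput Φ W B κ) / L ^ d) * κ))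

/-! ### Bifurcation -/

/-- All pairs `(u, κ) ∈ L²_S × (0, ∞)` with `Ḡ(u, κ) = 0`. -/
def solutionSet (Φ : ℝ → ℝ) (W : L2 d L) (B : ℝ) : Set (L2 d L × ℝ) :=
  {p | p.1 ∈ L2S d L ∧ 0 < p.2 ∧ IsStationaryMean Φ W B p.1 p.2}

/-- The branch of homogeneous solutions. -/
def homBranch (Φ : ℝ → ℝ) (W : L2 d L) (B : ℝ) : Set (L2 d L × ℝ) :=
  {p | 0 < p.2 ∧ p.1 = constL2 d L (rhoInf Φ W B p.2)}

/-- The point `(ρ̄∞^κ, κ)` of the homogeneous branch is a bifurcation point of `Ḡ = 0` in `L²_S`: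
it is a solution, and solutions off the homogeneous branch accumulate at it. -/
def IsBifurcationPoint (Φ : ℝ → ℝ) (W : L2 d L) (B κ : ℝ) : Prop :=
  (constL2 d L (rhoInf Φ W B κ), κ) ∈ solutionSet Φ W B ∧
  (constL2 d L (rhoInf Φ W B κ), κ) ∈ closure (solutionSet Φ W B \ homBranch Φ W B)

/-- Local description of the solutions in the space `V` near `(ρ̄∞^κ, κ)`: there is a `C¹` curve
`z ↦ (ρ z, k z)`, `|z| < δ`, of solutions in `V`, through the point `(ρ̄∞^κ, κ)`, non-homogeneous
for `z ≠ 0`, with `ρ z = ρ̄∞^{k z} + z ω + o(z)` both in `L²` and uniformly on the torus, such that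
in a neighbourhood of the point every solution in `V` lies on the homogeneous branch or
on the curve. -/
def HasBranch (Φ : ℝ → ℝ) (W : L2 d L) (B κ : ℝ) (V : Set (L2 d L))
    (ω : C(Torus d L, ℝ)) : Prop :=
  ∃ δ > 0, ∃ (ρ : ℝ → L2 d L) (k : ℝ → ℝ),
    ContDiffOn ℝ 1 ρ (Ioo (-δ) δ) ∧ ContDiffOn ℝ 1 k (Ioo (-δ) δ) ∧
    ρ 0 = constL2 d L (rhoInf Φ W B κ) ∧ k 0 = κ ∧
    (∀ z ∈ Ioo (-δ) δ, ρ z ∈ V ∧ 0 < k z ∧ IsStationaryMean Φ W B (ρ z) (k z)) ∧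
    (∀ z ∈ Ioo (-δ) δ, z ≠ 0 → ∀ c : ℝ, ρ z ≠ constL2 d L c) ∧
    (fun z : ℝ => ρ z - constL2 d L (rhoInf Φ W B (k z)) - z • toL2 ω) =o[𝓝 0] (fun z : ℝ => z) ∧
    (∀ η > 0, ∀ᶠ z in 𝓝 (0 : ℝ), ∀ᵐ x : Torus d L,
      |ρ z x - (rhoInf Φ W B (k z) + z * ω x)| ≤ η * |z|) ∧
    ∃ U ∈ 𝓝 (constL2 d L (rhoInf Φ W B κ)), ∃ ε > 0, ε ≤ κ ∧
      ∀ u ∈ U ∩ V, ∀ κ' ∈ Ioo (κ - ε) (κ + ε), IsStationaryMean Φ W B u κ' →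
        u = constL2 d L (rhoInf Φ W B κ') ∨ ∃ z ∈ Ioo (-δ) δ, u = ρ z ∧ κ' = k z

end NeuralField

end

/-! A stationary mean is a fixed point `u = R(W * u + B, κ)`, where `R(s, κ)` is `L⁻ᵈ` times the
mean of a Gaussian with centre `Φ s` and variance `1/κ` conditioned to be positive (`response`,
`truncMean`). Everything about this mean follows from the inverse Mills ratio `h` (`mills`), which
satisfies `h' = -h (t + h)`. For constants, `R` is nondecreasing in `s` and `W₀ < 0`, so the fixed
point is unique.

Put `u = ρ̄∞^κ + v`. Hadamard's lemma (`exists_response_slope`) writes the increment of `R` near the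
homogeneous input as `g(t, κ) t` with `g` of class `C¹`, and the equation becomes `v = ι (g(T v, κ)
T v)`, where `T v = W * v` and `ι` embeds continuous functions into `L²`. Convolution is compact
from `L²` to `C(𝕋ᵈ)`, and superposition with `g` is `C¹` on `C(𝕋ᵈ)`; it is also this gain of
continuity that yields the uniform expansion and makes hypotheses on `Φ` near `y₀` alone sufficient.

The curve comes from bifurcation at a simple eigenvalue (`exists_bifurcating_curve`). Inserting `v =
z (ω + w)` with `w ⊥ ω` and cancelling `z` leaves a `C¹` equation for `(w, κ)` as a function of `z`,
to which the implicit function theorem applies. This blow-up needs only `g ∈ C¹`, hence only `Φ ∈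
C²` near `y₀`. Its linearisation is identity minus compact, so injectivity suffices, and that
reduces to two facts.

The kernel is one-dimensional: cosine modes are eigenfunctions of convolution with an even kernel
and are complete among even functions, and (1) says exactly that the eigenvalue of the linearisation
at `ω_k` is 1 (`modeCondition_iff`). In case (ii) several modes resonate, but coefficients of
exchangeable functions are constant on `[k*]`, so restriction to the invariant subspace leaves a
line.

Transversality: `g(0, κ)`, the slope of `R` along the homogeneous branch, has positive derivative in
`κ`. Indeed `ρ̄∞^κ` decreases, so the input `W₀ ρ̄∞^κ + B` increases; `Φ'' ≥ 0`, and `h` is strictly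
convex on `[0, ∞)`, so the factor `truncVar` increases as well. This holds at every `κ > 0`. -/

noncomputable section

namespace NeuralField

open scoped InnerProductSpace

/-! ### Superposition operators on continuous functions -/

section Superposition

variable {X : Type*} [TopologicalSpace X] [CompactSpace X]

/-- The superposition operator `(f, κ) ↦ g (f ·, κ)` on continuous functions. -/
def superpos (g : C(ℝ × ℝ, ℝ)) (p : C(X, ℝ) × ℝ) : C(X, ℝ) :=
  g.comp (p.1.prodMk (ContinuousMap.const X p.2))

omit [CompactSpace X] in
@[simp]
theorem superpos_apply (g : C(ℝ × ℝ, ℝ)) (p : C(X, ℝ) × ℝ) (x : X) :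
    superpos g p x = g (p.1 x, p.2) := rfl

theorem continuous_prodMk_const :
    Continuous fun p : C(X, ℝ) × ℝ => p.1.prodMk (ContinuousMap.const X p.2) := by
  refine ContinuousMap.continuous_of_continuous_uncurry _ ?_
  have h : Continuous fun q : (C(X, ℝ) × ℝ) × X => (q.1.1 q.2, q.1.2) := by fun_prop
  exact h

theorem continuous_superpos (g : C(ℝ × ℝ, ℝ)) :
    Continuous (superpos g : C(X, ℝ) × ℝ → C(X, ℝ)) :=
  (ContinuousMap.continuous_postcomp g).comp continuous_prodMk_const

/-- The derivative of the superposition operator. -/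
def superposDeriv (a b : C(X, ℝ)) : C(X, ℝ) × ℝ →L[ℝ] C(X, ℝ) :=
  (ContinuousLinearMap.mul ℝ C(X, ℝ) a).comp (ContinuousLinearMap.fst ℝ _ _) +
    (ContinuousLinearMap.snd ℝ _ _).smulRight b

@[simp]
theorem superposDeriv_apply (a b : C(X, ℝ)) (h : C(X, ℝ) × ℝ) (x : X) :
    superposDeriv a b h x = a x * h.1 x + h.2 * b x := by
  simp [superposDeriv]

/-- The mean value inequality at each `x` reduces this to a modulus of continuity of `fderiv ℝ g`
around `(p.1 x, p.2)` that does not depend on `x`. Continuity of the superposition operators of the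
two partial derivatives provides it. -/
theorem hasFDerivAt_superpos (g : C(ℝ × ℝ, ℝ)) (hg : ContDiff ℝ 1 g) (p : C(X, ℝ) × ℝ) :
    HasFDerivAt (superpos g)
      (superposDeriv
        (superpos ⟨fun q => fderiv ℝ g q (1, 0),
          (hg.continuous_fderiv one_ne_zero).clm_apply continuous_const⟩ p)
        (superpos ⟨fun q => fderiv ℝ g q (0, 1),
          (hg.continuous_fderiv one_ne_zero).clm_apply continuous_const⟩ p)) p := by
  set g₁ : C(ℝ × ℝ, ℝ) := ⟨fun q => fderiv ℝ g q (1, 0),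
    (hg.continuous_fderiv one_ne_zero).clm_apply continuous_const⟩ with hg₁
  set g₂ : C(ℝ × ℝ, ℝ) := ⟨fun q => fderiv ℝ g q (0, 1),
    (hg.continuous_fderiv one_ne_zero).clm_apply continuous_const⟩ with hg₂
  rw [hasFDerivAt_iff_isLittleO_nhds_zero, isLittleO_iff]
  intro ε hε
  obtain ⟨δ₁, hδ₁, h₁⟩ := Metric.continuous_iff.1 (continuous_superpos (X := X) g₁) p _ (half_pos hε)
  obtain ⟨δ₂, hδ₂, h₂⟩ := Metric.continuous_iff.1 (continuous_superpos (X := X) g₂) p _ (half_pos hε)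
  set δ := min δ₁ δ₂
  have hδ : 0 < δ := lt_min hδ₁ hδ₂
  filter_upwards [Metric.ball_mem_nhds (0 : C(X, ℝ) × ℝ) hδ] with h hh
  rw [mem_ball_zero_iff] at hh
  rw [ContinuousMap.norm_le _ (by positivity)]
  intro x
  have key : ∀ y ∈ Metric.ball (p.1 x, p.2) δ,
      ‖fderiv ℝ g y - fderiv ℝ g (p.1 x, p.2)‖ ≤ ε := by
    intro y hy
    -- Shifting `p.1` by a constant produces a function near `p.1` that takes the value `y.1` at
    -- `x`, so continuity in the sup norm can be evaluated at an arbitrary nearby point `y`.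
    have hd : dist (p.1 + ContinuousMap.const X (y.1 - p.1 x), y.2) p < δ := by
      rw [mem_ball_iff_norm] at hy
      rw [dist_eq_norm]
      refine lt_of_le_of_lt ?_ hy
      rw [Prod.norm_def, Prod.norm_def]
      refine max_le_max ?_ le_rfl
      rw [ContinuousMap.norm_le _ (norm_nonneg _)]
      intro z
      simp
    have e₁ := (ContinuousMap.dist_apply_le_dist x).trans
      (h₁ _ (hd.trans_le (min_le_left _ _))).le
    have e₂ := (ContinuousMap.dist_apply_le_dist x).trans
      (h₂ _ (hd.trans_le (min_le_right _ _))).le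
    simp only [Real.dist_eq, superpos_apply, hg₁, hg₂, ContinuousMap.coe_mk,
      ContinuousMap.add_apply, ContinuousMap.const_apply, add_sub_cancel] at e₁ e₂
    refine ContinuousLinearMap.opNorm_le_bound _ hε.le fun v => ?_
    have hv : v = v.1 • (1, 0) + v.2 • (0, 1) := by simp
    rw [hv, map_add, map_smul, map_smul, ← hv]
    refine (norm_add_le _ _).trans ?_
    rw [norm_smul, norm_smul]
    have n₁ := norm_fst_le v
    have n₂ := norm_snd_le v
    have := mul_le_mul n₁ e₁ (abs_nonneg _) (norm_nonneg _)
    have := mul_le_mul n₂ e₂ (abs_nonneg _) (norm_nonneg _)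
    simp only [sub_apply, Real.norm_eq_abs] at *
    linarith
  have hx : ‖((h.1 x, h.2) : ℝ × ℝ)‖ ≤ ‖h‖ := by
    rw [Prod.norm_def, Prod.norm_def]
    exact max_le_max (ContinuousMap.norm_coe_le_norm _ x) le_rfl
  have h4 := (convex_ball (p.1 x, p.2) δ).norm_image_sub_le_of_norm_hasFDerivWithin_le'
    (f := g) (f' := fderiv ℝ g) (φ := fderiv ℝ g (p.1 x, p.2)) (C := ε)
    (x := (p.1 x, p.2)) (y := (p.1 x, p.2) + (h.1 x, h.2))
    (fun y _ => ((hg.differentiable one_ne_zero) y).hasFDerivAt.hasFDerivWithinAt) key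
    (Metric.mem_ball_self hδ) (by
      rw [mem_ball_iff_norm, add_sub_cancel_left]
      exact hx.trans_lt hh)
  rw [add_sub_cancel_left] at h4
  have h5 : ((h.1 x, h.2) : ℝ × ℝ) = h.1 x • (1, 0) + h.2 • (0, 1) := by simp
  have h6 : fderiv ℝ g (p.1 x, p.2) (h.1 x, h.2) =
      fderiv ℝ g (p.1 x, p.2) (1, 0) * h.1 x + h.2 * fderiv ℝ g (p.1 x, p.2) (0, 1) := by
    rw [h5, map_add, map_smul, map_smul, smul_eq_mul, smul_eq_mul, mul_comm (h.1 x)]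
  rw [h6] at h4
  simpa [hg₁, hg₂] using h4.trans (mul_le_mul_of_nonneg_left hx hε.le)

theorem contDiff_superpos (g : C(ℝ × ℝ, ℝ)) (hg : ContDiff ℝ 1 g) :
    ContDiff ℝ 1 (superpos g : C(X, ℝ) × ℝ → C(X, ℝ)) := by
  rw [contDiff_one_iff_hasFDerivAt]
  refine ⟨_, ?_, hasFDerivAt_superpos g hg⟩
  unfold superposDeriv
  refine Continuous.add ?_ ?_
  · exact ((ContinuousLinearMap.mul ℝ C(X, ℝ)).continuous.comp (continuous_superpos _)).clm_comp
      continuous_const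
  · exact ((ContinuousLinearMap.smulRightL ℝ (C(X, ℝ) × ℝ) C(X, ℝ)
      (ContinuousLinearMap.snd ℝ C(X, ℝ) ℝ)).continuous.comp (continuous_superpos _))

end Superposition

/-! ### Bifurcation from a simple eigenvalue -/

section Bifurcation

variable {X : Type*} [TopologicalSpace X] [CompactSpace X]

/-- A Fredholm operator of the form `1 - K`, `K` compact, is invertible if it is injective. -/
theorem isInvertible_of_isCompactOperator_sub {E : Type*} [NormedAddCommGroup E] [NormedSpace ℝ E]
    [CompleteSpace E] (D : E →L[ℝ] E)
    (hK : IsCompactOperator (ContinuousLinearMap.id ℝ E - D : E →L[ℝ] E))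
    (hD : ∀ x, D x = 0 → x = 0) : D.IsInvertible := by
  rcases hK.hasEigenvalue_or_mem_resolventSet one_ne_zero with h | h
  · obtain ⟨x, hx⟩ := h.exists_hasEigenvector
    have h1 : x - D x = x := by simpa using hx.apply_eq_smul
    exact absurd (hD x (by simpa using h1)) hx.2
  · rw [spectrum.mem_resolventSet_iff, map_one] at h
    have h1 : (1 : E →L[ℝ] E) - (ContinuousLinearMap.id ℝ E - D) = D := by
      ext x; simp
    rw [h1, ContinuousLinearMap.isUnit_iff_bijective] at h
    exact ⟨ContinuousLinearEquiv.ofBijective D (LinearMap.ker_eq_bot.2 h.1)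
      (LinearMap.range_eq_top.2 h.2), by ext x; simp⟩

variable {H : Type*} [NormedAddCommGroup H] [InnerProductSpace ℝ H]

/-- The bordered linearisation `(w, μ) ↦ (w - c A w - μ e, ⟪ω, w⟫)` of a bifurcation equation
is invertible if `A` is compact and symmetric with `c A ω = ω`, `e` is not orthogonal to `ω`, and
`ω` spans the kernel of `1 - c A`. -/
theorem isInvertible_bordered [CompleteSpace H] (A : H →L[ℝ] H) (hA : IsCompactOperator A)
    (hsymm : ∀ u v, ⟪A u, v⟫_ℝ = ⟪u, A v⟫_ℝ) (c : ℝ) (ω e : H) (hω : c • A ω = ω)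
    (he : ⟪ω, e⟫_ℝ ≠ 0) (hker : ∀ v, c • A v = v → ⟪ω, v⟫_ℝ = 0 → v = 0)
    (D : H × ℝ →L[ℝ] H × ℝ)
    (hD : ∀ x, D x = (x.1 - (c • A x.1 + x.2 • e), ⟪ω, x.1⟫_ℝ)) : D.IsInvertible := by
  apply isInvertible_of_isCompactOperator_sub
  -- Identity minus `D` is `c A` on the first factor plus an operator `Q ∘ S` that factors through
  -- `ℝ × ℝ`, hence compact.
  · let S : H × ℝ →L[ℝ] ℝ × ℝ := (ContinuousLinearMap.snd ℝ H ℝ).prod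
      ((innerSL ℝ ω).comp (ContinuousLinearMap.fst ℝ H ℝ))
    let Q : ℝ × ℝ →L[ℝ] H × ℝ := ((ContinuousLinearMap.fst ℝ ℝ ℝ).smulRight e).prod
      (ContinuousLinearMap.fst ℝ ℝ ℝ - ContinuousLinearMap.snd ℝ ℝ ℝ)
    have hQ : IsCompactOperator Q := isCompactOperator_of_locallyCompactSpace_rng Q
    have h1 := ((hA.comp_clm (ContinuousLinearMap.fst ℝ H ℝ)).smul c).clm_comp
      (ContinuousLinearMap.inl ℝ H ℝ)
    have h2 := h1.add (hQ.comp_clm S)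
    have h3 : ⇑(ContinuousLinearMap.id ℝ (H × ℝ) - D) =
        ContinuousLinearMap.inl ℝ H ℝ ∘ (c • ⇑A ∘ ContinuousLinearMap.fst ℝ H ℝ) + Q ∘ S := by
      funext x
      apply Prod.ext <;> simp [hD, S, Q]
    rw [h3]
    exact h2
  · rintro ⟨w, μ⟩ h
    rw [hD, Prod.mk_eq_zero] at h
    obtain ⟨h1, h2⟩ := h
    simp only at h1 h2
    -- Pairing the first equation with `ω` removes `w` by symmetry of `A` and leaves `μ ⟪ω, e⟫ = 0`.
    have h3 : ⟪ω, c • A w⟫_ℝ = 0 := by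
      rw [inner_smul_right, ← hsymm, ← real_inner_smul_left, hω, h2]
    have h4 := congrArg (fun x => ⟪ω, x⟫_ℝ) h1
    simp only [inner_sub_right, inner_add_right, h3, h2, inner_smul_right, inner_zero_right] at h4
    have h5 : μ = 0 := by
      rcases mul_eq_zero.1 (show μ * ⟪ω, e⟫_ℝ = 0 by linarith) with h | h
      · exact h
      · exact absurd h he
    subst h5
    rw [zero_smul, add_zero, sub_eq_zero] at h1
    rw [hker w h1.symm h2]
    rfl

/-- Bifurcation from a simple eigenvalue for the equation `v = ι (g (T v, κ) * T v)`. -/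
theorem exists_bifurcating_curve_aux [CompleteSpace H] (T : H →L[ℝ] C(X, ℝ)) (ι : C(X, ℝ) →L[ℝ] H)
    (g : C(ℝ × ℝ, ℝ)) (hg : ContDiff ℝ 1 g) (κ₀ a : ℝ) (hcomp : IsCompactOperator (ι ∘L T))
    (hsymm : ∀ u v, ⟪ι (T u), v⟫_ℝ = ⟪u, ι (T v)⟫_ℝ)
    (ω : H) (hω : g (0, κ₀) • ι (T ω) = ω) (hne : ω ≠ 0)
    (hker : ∀ v, g (0, κ₀) • ι (T v) = v → ⟪ω, v⟫_ℝ = 0 → v = 0)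
    (ha : HasDerivAt (fun κ => g (0, κ)) a κ₀) (ha0 : a ≠ 0) :
    ∃ (w : ℝ → H) (k : ℝ → ℝ), ContDiffAt ℝ 1 w 0 ∧ ContDiffAt ℝ 1 k 0 ∧ w 0 = 0 ∧ k 0 = κ₀ ∧
      (∀ᶠ z in 𝓝 (0 : ℝ), ⟪ω, w z⟫_ℝ = 0 ∧
        ω + w z = ι (superpos g (z • T (ω + w z), k z) * T (ω + w z))) ∧
      ∀ᶠ p in 𝓝 ((0 : H), κ₀), p.1 = ι (superpos g (T p.1, p.2) * T p.1) →
        p.1 = 0 ∨ (p.1 = (⟪ω, p.1⟫_ℝ / ‖ω‖ ^ 2) • (ω + w (⟪ω, p.1⟫_ℝ / ‖ω‖ ^ 2)) ∧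
          p.2 = k (⟪ω, p.1⟫_ℝ / ‖ω‖ ^ 2)) := by
  set c := g (0, κ₀) with hc
  have hc0 : c ≠ 0 := fun h => hne (by rw [← hω, h, zero_smul])
  have hωω : ⟪ω, ω⟫_ℝ ≠ 0 := inner_self_ne_zero.2 hne
  -- The equation for `v = z (ω + w)` divided by `z`, together with `w ⊥ ω`. The division is exact
  -- because the nonlinearity is `g(T v, κ)` times `T v`, so no derivative is lost.
  let Ψ : ℝ × (H × ℝ) → H × ℝ := fun q =>
    (ω + q.2.1 - ι (superpos g (q.1 • T (ω + q.2.1), q.2.2) * T (ω + q.2.1)), ⟪ω, q.2.1⟫_ℝ)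
  have hsup := contDiff_superpos (X := X) g hg
  have hΨ : ContDiff ℝ 1 Ψ := by
    have h1 : ContDiff ℝ 1 fun q : ℝ × (H × ℝ) => T (ω + q.2.1) := by fun_prop
    have h2 : ContDiff ℝ 1 fun q : ℝ × (H × ℝ) =>
        superpos g (q.1 • T (ω + q.2.1), q.2.2) :=
      hsup.comp ((contDiff_fst.smul h1).prodMk (by fun_prop))
    refine ContDiff.prodMk ?_ (contDiff_const.inner ℝ (contDiff_fst.comp contDiff_snd))
    exact (by fun_prop : ContDiff ℝ 1 fun q : ℝ × (H × ℝ) => ω + q.2.1).sub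
      (ι.contDiff.comp (h2.mul h1))
  have hs0 : ∀ κ, superpos g ((0 : C(X, ℝ)), κ) = ContinuousMap.const X (g (0, κ)) := fun κ => by
    ext x; simp
  have hcm : ∀ (s : ℝ) (f : C(X, ℝ)), ContinuousMap.const X s * f = s • f := fun s f => by
    ext x; simp
  have hΨ0 : ∀ x : H × ℝ, Ψ (0, x) = (ω + x.1 - g (0, x.2) • ι (T (ω + x.1)), ⟪ω, x.1⟫_ℝ) :=
    fun x => by simp only [Ψ, zero_smul, hs0, hcm, map_smul]
  set u : ℝ × (H × ℝ) := (0, (0, κ₀)) with hu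
  have hΨu : Ψ u = 0 := by
    rw [hu, hΨ0]
    simp [← hc, hω]
  set D : H × ℝ →L[ℝ] H × ℝ := fderiv ℝ Ψ u ∘L .inr ℝ ℝ (H × ℝ) with hD
  -- The partial derivative in `(w, κ)` can be read off the slice `z = 0`, where `g` enters only
  -- through the scalar `g (0, κ)`.
  have hD1 : HasFDerivAt (fun x : H × ℝ => Ψ (0, x)) D (0, κ₀) := by
    have h1 : HasFDerivAt Ψ (fderiv ℝ Ψ u) ((fun x : H × ℝ => ((0 : ℝ), x)) (0, κ₀)) :=
      (hΨ.differentiable one_ne_zero u).hasFDerivAt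
    exact h1.comp _ (hasFDerivAt_prodMk_right (0 : ℝ) ((0 : H), κ₀))
  have hD2 : ∀ x, D x = (x.1 - (c • (ι ∘L T) x.1 + x.2 • (a • ι (T ω))), ⟪ω, x.1⟫_ℝ) := by
    have h1 : HasFDerivAt (fun x : H × ℝ => g (0, x.2))
        ((ContinuousLinearMap.toSpanSingleton ℝ a).comp (ContinuousLinearMap.snd ℝ H ℝ)) (0, κ₀) :=
      (show HasFDerivAt (fun κ => g (0, κ)) _ ((fun x : H × ℝ => x.2) (0, κ₀)) from
        ha.hasFDerivAt).comp _ hasFDerivAt_snd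
    have h2 : HasFDerivAt (fun x : H × ℝ => ω + x.1) (ContinuousLinearMap.fst ℝ H ℝ) (0, κ₀) :=
      hasFDerivAt_fst.const_add ω
    have h3 : HasFDerivAt (fun x : H × ℝ => ι (T (ω + x.1)))
        ((ι ∘L T).comp (ContinuousLinearMap.fst ℝ H ℝ)) (0, κ₀) :=
      (ι ∘L T).hasFDerivAt.comp _ h2
    have h4 : HasFDerivAt (fun x : H × ℝ => ⟪ω, x.1⟫_ℝ)
        ((innerSL ℝ ω).comp (ContinuousLinearMap.fst ℝ H ℝ)) (0, κ₀) :=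
      (innerSL ℝ ω).hasFDerivAt.comp _ hasFDerivAt_fst
    have h5 := (h2.sub (h1.smul h3)).prodMk h4
    have h6 := hD1.unique (h5.congr_of_eventuallyEq (Eventually.of_forall hΨ0))
    intro x
    rw [h6]
    simp [← hc, smul_smul]
  have hinv : D.IsInvertible := by
    refine isInvertible_bordered (ι ∘L T) hcomp hsymm c ω (a • ι (T ω)) hω ?_ hker D hD2
    -- The bordering vector is `(a / c) ω`, so its pairing with `ω` is nonzero precisely by the
    -- transversality `a ≠ 0`.
    have : ι (T ω) = c⁻¹ • ω := by rw [← hω, smul_smul, hω, inv_mul_cancel₀ hc0, one_smul]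
    rw [this, inner_smul_right, inner_smul_right]
    exact mul_ne_zero ha0 (mul_ne_zero (inv_ne_zero hc0) hωω)
  have cdf : ContDiffAt ℝ 1 Ψ u := hΨ.contDiffAt
  set F := cdf.implicitFunction one_ne_zero hinv with hF
  have hFC : ContDiffAt ℝ 1 F 0 := cdf.contDiffAt_implicitFunction one_ne_zero hinv
  have hF0 : F 0 = (0, κ₀) := cdf.implicitFunction_apply_self one_ne_zero hinv
  have hFe : ∀ᶠ z in 𝓝 (0 : ℝ), Ψ (z, F z) = Ψ u :=
    cdf.eventually_apply_implicitFunction one_ne_zero hinv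
  have hFu : ∀ᶠ q in 𝓝 u, Ψ q = Ψ u ↔ F q.1 = q.2 :=
    cdf.eventually_apply_eq_iff_implicitFunction one_ne_zero hinv
  refine ⟨fun z => (F z).1, fun z => (F z).2, hFC.fst, hFC.snd, by simp [hF0], by simp [hF0],
    ?_, ?_⟩
  · filter_upwards [hFe] with z hz
    rw [hΨu] at hz
    have h1 := congrArg Prod.fst hz
    have h2 := congrArg Prod.snd hz
    exact ⟨h2, sub_eq_zero.1 h1⟩
  obtain ⟨C, hC0, hC⟩ : ∃ C > 0, ∀ x, ‖x‖ ≤ C * ‖D x‖ := by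
    obtain ⟨M, hM⟩ := hinv
    refine ⟨‖(M.symm : H × ℝ →L[ℝ] H × ℝ)‖ + 1, by positivity, fun x => ?_⟩
    have h1 : x = M.symm (D x) := by rw [← hM]; simp
    calc ‖x‖ = ‖(M.symm : H × ℝ →L[ℝ] H × ℝ) (D x)‖ := by rw [h1, ← hM]; simp
      _ ≤ _ := (M.symm : H × ℝ →L[ℝ] H × ℝ).le_opNorm _
      _ ≤ _ := by gcongr; linarith
  obtain ⟨δ, hδ, hball⟩ := Metric.eventually_nhds_iff.1 hFu
  set Q : ℝ := ‖ι‖ * ‖T‖ + 1 with hQ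
  have hQ0 : 0 < Q := by positivity
  have hωn : 0 < ‖ω‖ := norm_pos_iff.2 hne
  -- The first bound makes `C Q η ≤ 1/2`, which absorbs `‖r‖` on the right of its own estimate; the
  -- second makes `C Q η ‖ω‖ ≤ δ/4`. Together they give `‖r‖ ≤ (δ/2) |z|`, so `r / z` falls in the
  -- uniqueness ball of the implicit function theorem.
  set η : ℝ := min (1 / (2 * C * Q)) (δ / (4 * C * Q * ‖ω‖)) with hη
  have hη0 : 0 < η := lt_min (by positivity) (by positivity)
  have e1 : ∀ᶠ p in 𝓝 ((0 : H), κ₀),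
      dist (superpos g (T p.1, p.2)) (ContinuousMap.const X c) < η := by
    have h1 : Continuous fun p : H × ℝ => superpos g (T p.1, p.2) :=
      (continuous_superpos g).comp (by fun_prop)
    have h2 := h1.tendsto ((0 : H), κ₀)
    simp only [map_zero, hs0] at h2
    exact Metric.tendsto_nhds.1 h2 η hη0
  have e2 : ∀ᶠ p in 𝓝 ((0 : H), κ₀), |⟪ω, p.1⟫_ℝ / ‖ω‖ ^ 2| < δ := by
    have h1 : Continuous fun p : H × ℝ => |⟪ω, p.1⟫_ℝ / ‖ω‖ ^ 2| := by fun_prop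
    refine h1.tendsto _ |>.eventually_lt_const ?_
    simpa using hδ
  have e3 : ∀ᶠ p in 𝓝 ((0 : H), κ₀), dist p.2 κ₀ < δ := by
    have h1 : Continuous fun p : H × ℝ => dist p.2 κ₀ := by fun_prop
    refine h1.tendsto _ |>.eventually_lt_const ?_
    simpa using hδ
  filter_upwards [e1, e2, e3] with p h1 h2 h3 hp
  obtain ⟨v, κ⟩ := p
  simp only at h1 h2 h3 hp ⊢
  set z := ⟪ω, v⟫_ℝ / ‖ω‖ ^ 2 with hz
  set r := v - z • ω with hr
  have hωr : ⟪ω, r⟫_ℝ = 0 := by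
    rw [hr, inner_sub_right, inner_smul_right, real_inner_self_eq_norm_sq, hz]
    field_simp
    ring
  -- The component `r` of a solution orthogonal to `ω` solves the linearised equation with
  -- right-hand side `ι ((g(T v, κ) - c) T v)`, which is a small multiple of `‖v‖`.
  have hDr : D (r, 0) = (ι ((superpos g (T v, κ) - ContinuousMap.const X c) * T v), 0) := by
    rw [hD2, sub_mul, hcm, map_sub ι, ← hp]
    simp only [zero_smul, add_zero, hωr, ContinuousLinearMap.comp_apply, Prod.mk.injEq, and_true]
    have : c • ι (T r) = c • ι (T v) - z • ω := by
      rw [hr, map_sub, map_sub, map_smul, map_smul, smul_sub, smul_comm c z, hω]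
    rw [this, map_smul ι, hr]
    abel
  have hrle : ‖r‖ ≤ C * (Q * η * ‖v‖) := by
    have h4 := hC (r, 0)
    rw [hDr] at h4
    have h5 : ‖((r, 0) : H × ℝ)‖ = ‖r‖ := by simp [Prod.norm_def]
    rw [h5] at h4
    refine h4.trans ?_
    gcongr
    rw [Prod.norm_def, norm_zero, max_eq_left (norm_nonneg _)]
    calc _ ≤ ‖ι‖ * ‖(superpos g (T v, κ) - ContinuousMap.const X c) * T v‖ := ι.le_opNorm _
      _ ≤ ‖ι‖ * (η * (‖T‖ * ‖v‖)) := by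
        gcongr
        refine (norm_mul_le _ _).trans ?_
        gcongr
        · rw [← dist_eq_norm]; exact h1.le
        · exact T.le_opNorm _
      _ = (‖ι‖ * ‖T‖) * η * ‖v‖ := by ring
      _ ≤ Q * η * ‖v‖ := by gcongr; linarith
  have hvr : v = z • ω + r := by rw [hr]; abel
  have hvle : ‖v‖ ≤ |z| * ‖ω‖ + ‖r‖ := by
    conv_lhs => rw [hvr]
    refine (norm_add_le _ _).trans ?_
    rw [norm_smul, Real.norm_eq_abs]
  have hCQ : C * (Q * η) ≤ 1 / 2 := by
    have : η ≤ 1 / (2 * C * Q) := min_le_left _ _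
    rw [le_div_iff₀ (by positivity)] at this
    linarith
  have hCQ' : C * (Q * η) * ‖ω‖ ≤ δ / 4 := by
    have : η ≤ δ / (4 * C * Q * ‖ω‖) := min_le_right _ _
    rw [le_div_iff₀ (by positivity)] at this
    linarith
  have hrz : ‖r‖ ≤ δ / 2 * |z| := by
    have h4 : ‖r‖ ≤ C * (Q * η) * (|z| * ‖ω‖ + ‖r‖) := by
      refine hrle.trans ?_
      rw [← mul_assoc]
      exact mul_le_mul_of_nonneg_left hvle (by positivity)
    have h5 : C * (Q * η) * ‖r‖ ≤ 1 / 2 * ‖r‖ := by gcongr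
    have h6 : C * (Q * η) * ‖ω‖ * |z| ≤ δ / 4 * |z| := by gcongr
    linarith
  by_cases hz0 : z = 0
  · left
    rw [hz0, abs_zero, mul_zero] at hrz
    rw [hvr, hz0, zero_smul, zero_add]
    exact norm_le_zero_iff.1 hrz
  right
  have hv : v = z • (ω + z⁻¹ • r) := by
    rw [smul_add, smul_smul, mul_inv_cancel₀ hz0, one_smul, ← hvr]
  have hw : ‖z⁻¹ • r‖ < δ := by
    rw [norm_smul, norm_inv, Real.norm_eq_abs]
    have : 0 < |z| := abs_pos.2 hz0
    rw [inv_mul_lt_iff₀ this]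
    calc ‖r‖ ≤ δ / 2 * |z| := hrz
      _ < |z| * δ := by nlinarith
  have hq : Ψ (z, (z⁻¹ • r, κ)) = Ψ u := by
    rw [hΨu]
    simp only [Ψ]
    rw [← map_smul T, ← hv, inner_smul_right, hωr, mul_zero, Prod.mk_eq_zero]
    refine ⟨?_, rfl⟩
    have h4 : ω + z⁻¹ • r = z⁻¹ • v := by
      rw [hv, smul_smul, inv_mul_cancel₀ hz0, one_smul]
    rw [h4, map_smul T, mul_smul_comm, map_smul ι, ← hp, sub_self]
  have hFz := (hball (y := (z, (z⁻¹ • r, κ))) (by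
    rw [hu, Prod.dist_eq, Prod.dist_eq]
    simp only [dist_zero_right]
    exact max_lt h2 (max_lt hw h3))).1 hq
  simp only at hFz
  rw [hFz]
  exact ⟨hv, rfl⟩

/-- Bifurcation from a simple eigenvalue for the equation `v = ι (g (T v, κ) * T v)` in a closed
invariant subspace `V`. -/
theorem exists_bifurcating_curve (V : Submodule ℝ H) [CompleteSpace V] (T : H →L[ℝ] C(X, ℝ))
    (ι : C(X, ℝ) →L[ℝ] H) (g : C(ℝ × ℝ, ℝ)) (hg : ContDiff ℝ 1 g) (κ₀ a : ℝ)
    (hcomp : IsCompactOperator (ι ∘L T)) (hsymm : ∀ u v, ⟪ι (T u), v⟫_ℝ = ⟪u, ι (T v)⟫_ℝ)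
    (hVT : ∀ u ∈ V, ι (T u) ∈ V)
    (hV : ∀ u ∈ V, ∀ z κ : ℝ, ι (superpos g (z • T u, κ) * T u) ∈ V)
    (ω : C(X, ℝ)) (hωV : ι ω ∈ V) (hω : g (0, κ₀) • T (ι ω) = ω) (hne : ι ω ≠ 0)
    (hker : ∀ v ∈ V, g (0, κ₀) • ι (T v) = v → ⟪ι ω, v⟫_ℝ = 0 → v = 0)
    (ha : HasDerivAt (fun κ => g (0, κ)) a κ₀) (ha0 : a ≠ 0) :
    ∃ (w : ℝ → H) (k : ℝ → ℝ) (η : ℝ → C(X, ℝ)),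
      ContDiffAt ℝ 1 w 0 ∧ ContDiffAt ℝ 1 k 0 ∧ w 0 = 0 ∧ k 0 = κ₀ ∧ (∀ z, w z ∈ V) ∧
      Tendsto η (𝓝 0) (𝓝 0) ∧
      (∀ᶠ z in 𝓝 (0 : ℝ), ⟪ι ω, w z⟫_ℝ = 0 ∧ w z = ι (η z) ∧
        ι ω + w z = ι (superpos g (z • T (ι ω + w z), k z) * T (ι ω + w z))) ∧
      ∀ᶠ p in 𝓝 ((0 : H), κ₀), p.1 ∈ V → p.1 = ι (superpos g (T p.1, p.2) * T p.1) →
        p.1 = 0 ∨ (p.1 = (⟪ι ω, p.1⟫_ℝ / ‖ι ω‖ ^ 2) • (ι ω + w (⟪ι ω, p.1⟫_ℝ / ‖ι ω‖ ^ 2)) ∧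
          p.2 = k (⟪ι ω, p.1⟫_ℝ / ‖ι ω‖ ^ 2)) := by
  -- Replacing `ι` by `P ∘ ι` gives an equation on `V`. Invariance of `V` makes it agree with the
  -- original equation there, and compactness and symmetry survive the compression.
  let P : H →L[ℝ] V := V.orthogonalProjectionOnto
  have hP : ∀ u (hu : u ∈ V), P u = ⟨u, hu⟩ := fun u hu =>
    V.orthogonalProjectionOnto_mem_subspace_eq_self ⟨u, hu⟩
  have hPc : ∀ u ∈ V, (P u : H) = u := fun u hu => by rw [hP u hu]
  have hPi : ∀ (u : H) (v : V), ⟪P u, v⟫_ℝ = ⟪u, (v : H)⟫_ℝ := fun u v =>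
    V.inner_orthogonalProjectionOnto_eq_of_mem_right v u
  obtain ⟨w, k, hw, hk, hw0, hk0, hwe, hwu⟩ := exists_bifurcating_curve_aux (T ∘L V.subtypeL)
    (P ∘L ι) g hg κ₀ a ((hcomp.comp_clm V.subtypeL).clm_comp P)
    (fun u v => by
      simp only [ContinuousLinearMap.comp_apply, Submodule.subtypeL_apply]
      rw [hPi, hsymm, real_inner_comm, ← hPi, real_inner_comm])
    ⟨ι ω, hωV⟩ (by
      simp only [ContinuousLinearMap.comp_apply, Submodule.subtypeL_apply]
      rw [← map_smul, ← map_smul, hω, hP _ hωV])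
    (fun h => hne (congrArg Subtype.val h))
    (fun v hv hωv => by
      simp only [ContinuousLinearMap.comp_apply, Submodule.subtypeL_apply] at hv
      refine Subtype.ext (hker v v.2 ?_ hωv)
      have := congrArg Subtype.val hv
      rwa [Submodule.coe_smul, hPc _ (hVT _ v.2)] at this)
    ha ha0
  let f : ℝ → C(X, ℝ) := fun z => T (ι ω + w z)
  have hwe' : ∀ᶠ z in 𝓝 (0 : ℝ), ⟪ι ω, (w z : H)⟫_ℝ = 0 ∧
      ι ω + w z = ι (superpos g (z • f z, k z) * f z) := by
    filter_upwards [hwe] with z hz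
    refine ⟨hz.1, ?_⟩
    have h1 := congrArg Subtype.val hz.2
    simp only [ContinuousLinearMap.comp_apply, Submodule.subtypeL_apply] at h1
    rw [hPc _ (hV _ (Submodule.coe_mem _) _ _)] at h1
    exact h1
  -- The equation itself exhibits `w z` as the class of this continuous function. It depends
  -- continuously on `z` in the sup norm and vanishes at `z = 0` by the eigenvalue equation, whence
  -- the uniform expansion.
  refine ⟨fun z => w z, k, fun z => superpos g (z • f z, k z) * f z - ω,
    V.subtypeL.contDiff.contDiffAt.comp _ hw, hk, by simp [hw0], hk0, fun z => (w z).2, ?_, ?_, ?_⟩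
  · have hf : ContinuousAt f 0 := by
      have : ContinuousAt w 0 := hw.continuousAt
      fun_prop
    have h1 : ContinuousAt (fun z => superpos g (z • f z, k z) * f z - ω) 0 :=
      (((continuous_superpos g).continuousAt.comp
        ((continuousAt_id.smul hf).prodMk hk.continuousAt)).mul hf).sub continuousAt_const
    have h2 : superpos g ((0 : ℝ) • f 0, k 0) * f 0 - ω = 0 := by
      have h3 : f 0 = T (ι ω) := by simp [f, hw0]
      rw [h3, hk0, zero_smul, sub_eq_zero]
      conv_rhs => rw [← hω]
      ext x
      simp
    have h4 := h1.tendsto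
    simp only [h2] at h4
    exact h4
  · filter_upwards [hwe'] with z hz
    exact ⟨hz.1, by rw [map_sub, ← hz.2, add_sub_cancel_left], hz.2⟩
  · have hc : Tendsto (fun p : H × ℝ => (P p.1, p.2)) (𝓝 ((0 : H), κ₀)) (𝓝 ((0 : V), κ₀)) := by
      have : Continuous fun p : H × ℝ => (P p.1, p.2) := by fun_prop
      simpa using this.tendsto ((0 : H), κ₀)
    filter_upwards [hc.eventually hwu] with p hp hpV heq
    simp only [ContinuousLinearMap.comp_apply, Submodule.subtypeL_apply, hP p.1 hpV] at hp
    rw [← heq, hP p.1 hpV] at hp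
    rcases hp rfl with h | ⟨h1, h2⟩
    · exact Or.inl (congrArg Subtype.val h)
    · exact Or.inr ⟨congrArg Subtype.val h1, h2⟩

end Bifurcation

/-! ### The truncated Gaussian and the inverse Mills ratio -/

section TruncatedGaussian

/-- The Gaussian integral `∫_{-t}^∞ exp (-s ^ 2 / 2) ds`. -/
def gaussMass (t : ℝ) : ℝ := √(Real.pi / 2) + ∫ s in (0 : ℝ)..t, Real.exp (-s ^ 2 / 2)

theorem hasDerivAt_gaussMass (t : ℝ) : HasDerivAt gaussMass (Real.exp (-t ^ 2 / 2)) t := by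
  have hc : Continuous fun s : ℝ => Real.exp (-s ^ 2 / 2) := by fun_prop
  exact (intervalIntegral.integral_hasDerivAt_right (hc.intervalIntegrable _ _)
    (hc.stronglyMeasurableAtFilter _ _) hc.continuousAt).const_add _

theorem gaussMass_zero : gaussMass 0 = √(Real.pi / 2) := by simp [gaussMass]

theorem gaussMass_neg (t : ℝ) : gaussMass (-t) = 2 * √(Real.pi / 2) - gaussMass t := by
  have h := intervalIntegral.integral_comp_neg (a := 0) (b := t)
    (fun s : ℝ => Real.exp (-s ^ 2 / 2))
  simp only [neg_sq, neg_zero] at h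
  rw [gaussMass, gaussMass, h, intervalIntegral.integral_symm (-t) 0]
  ring

theorem tendsto_gaussMass : Tendsto gaussMass atTop (𝓝 (2 * √(Real.pi / 2))) := by
  have h1 : ∀ s : ℝ, Real.exp (-s ^ 2 / 2) = Real.exp (-(1 / 2) * s ^ 2) := fun s => by
    congr 1; ring
  have h2 := intervalIntegral_tendsto_integral_Ioi (0 : ℝ)
    (integrable_exp_neg_mul_sq (b := 1 / 2) (by norm_num)).integrableOn tendsto_id
  rw [integral_gaussian_Ioi] at h2
  have h3 := h2.const_add √(Real.pi / 2)
  have h4 : √(Real.pi / 2) + √(Real.pi / (1 / 2)) / 2 = 2 * √(Real.pi / 2) := by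
    have : Real.pi / (1 / 2) = 2 ^ 2 * (Real.pi / 2) := by ring
    rw [this, Real.sqrt_mul (by norm_num), Real.sqrt_sq (by norm_num)]
    ring
  rw [h4] at h3
  unfold gaussMass
  simp_rw [h1]
  exact h3

variable (κ φ : ℝ)

theorem hasDerivAt_gaussMass_comp (hκ : 0 < κ) (s : ℝ) :
    HasDerivAt (fun s => gaussMass (√κ * (s - φ)) / √κ) (Real.exp (-κ * (s - φ) ^ 2 / 2)) s := by
  have h1 : HasDerivAt (fun s => √κ * (s - φ)) (√κ * 1) s :=
    ((hasDerivAt_id s).sub_const φ).const_mul _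
  have h2 := ((hasDerivAt_gaussMass _).comp s h1).div_const √κ
  have h3 : 0 < √κ := Real.sqrt_pos.2 hκ
  refine h2.congr_deriv ?_
  rw [mul_pow, Real.sq_sqrt hκ.le, mul_one, mul_div_assoc, div_self h3.ne', mul_one]
  congr 1
  ring

theorem tendsto_gaussMass_comp (hκ : 0 < κ) :
    Tendsto (fun s => gaussMass (√κ * (s - φ)) / √κ) atTop (𝓝 (2 * √(Real.pi / 2) / √κ)) := by
  refine (tendsto_gaussMass.comp ?_).div_const _
  exact (tendsto_atTop_add_const_right _ (-φ) tendsto_id).const_mul_atTop (Real.sqrt_pos.2 hκ)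

theorem integrableOn_gaussWeight (hκ : 0 < κ) :
    IntegrableOn (fun s => Real.exp (-κ * (s - φ) ^ 2 / 2)) (Ioi 0) :=
  integrableOn_Ioi_deriv_of_nonneg' (fun s _ => hasDerivAt_gaussMass_comp κ φ hκ s)
    (fun _ _ => (Real.exp_pos _).le) (tendsto_gaussMass_comp κ φ hκ)

theorem integral_gaussWeight (hκ : 0 < κ) :
    ∫ s in Ioi (0 : ℝ), Real.exp (-κ * (s - φ) ^ 2 / 2) = gaussMass (√κ * φ) / √κ := by
  rw [integral_Ioi_of_hasDerivAt_of_nonneg' (fun s _ => hasDerivAt_gaussMass_comp κ φ hκ s)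
    (fun _ _ => (Real.exp_pos _).le) (tendsto_gaussMass_comp κ φ hκ)]
  rw [zero_sub, mul_neg, gaussMass_neg]
  ring

theorem gaussMass_pos (t : ℝ) : 0 < gaussMass t := by
  have h := integral_gaussWeight 1 t one_pos
  simp only [Real.sqrt_one, one_mul, div_one] at h
  rw [← h]
  have : NeZero (volume.restrict (Ioi (0 : ℝ))) := ⟨by simp⟩
  exact integral_exp_pos (integrableOn_gaussWeight 1 t one_pos)

/-- Split `s = φ + (s - φ)`: the first part is `φ` times the mass, the second is an exact derivative
and contributes a boundary term at `0`. -/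
theorem integral_mul_gaussWeight (hκ : 0 < κ) :
    ∫ s in Ioi (0 : ℝ), s * Real.exp (-κ * (s - φ) ^ 2 / 2) =
      φ * (gaussMass (√κ * φ) / √κ) + Real.exp (-(√κ * φ) ^ 2 / 2) / κ := by
  have hd : ∀ s ∈ Ici (0 : ℝ), HasDerivAt
      (fun s => φ * (gaussMass (√κ * (s - φ)) / √κ) - Real.exp (-κ * (s - φ) ^ 2 / 2) / κ)
      (s * Real.exp (-κ * (s - φ) ^ 2 / 2)) s := fun s _ => by
    have h1 : HasDerivAt (fun s => -κ * (s - φ) ^ 2 / 2) (-κ * (s - φ)) s := by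
      have := ((((hasDerivAt_id s).sub_const φ).pow 2).const_mul (-κ)).div_const 2
      refine this.congr_deriv ?_
      simp
      ring
    refine (((hasDerivAt_gaussMass_comp κ φ hκ s).const_mul φ).sub
      (h1.exp.div_const κ)).congr_deriv ?_
    field_simp
    ring
  have hl : Tendsto (fun s => Real.exp (-κ * (s - φ) ^ 2 / 2) / κ) atTop (𝓝 (0 / κ)) := by
    refine Tendsto.div_const (Real.tendsto_exp_atBot.comp ?_) _
    have h1 : Tendsto (fun s : ℝ => s - φ) atTop atTop :=
      tendsto_atTop_add_const_right _ (-φ) tendsto_id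
    have h2 := ((tendsto_pow_atTop two_ne_zero).comp h1).const_mul_atTop_of_neg
      (show -κ / 2 < 0 by linarith)
    refine h2.congr fun s => ?_
    simp only [Function.comp]
    ring
  rw [integral_Ioi_of_hasDerivAt_of_nonneg' hd
    (fun s hs => mul_nonneg (le_of_lt hs) (Real.exp_pos _).le)
    (((tendsto_gaussMass_comp κ φ hκ).const_mul φ).sub hl)]
  rw [zero_sub, mul_neg, gaussMass_neg, mul_pow, Real.sq_sqrt hκ.le]
  have : -κ * (-φ) ^ 2 / 2 = -(κ * φ ^ 2) / 2 := by ring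
  rw [this]
  ring

/-- The inverse Mills ratio `exp (-t ^ 2 / 2) / ∫_{-t}^∞ exp (-s ^ 2 / 2) ds`. -/
def mills (t : ℝ) : ℝ := Real.exp (-t ^ 2 / 2) / gaussMass t

/-- The mean of the Gaussian with mean `φ` and variance `1 / κ`, conditioned to be positive. -/
def truncMean (φ κ : ℝ) : ℝ := φ + mills (√κ * φ) / √κ

theorem integral_ratio_eq_truncMean (hκ : 0 < κ) :
    (∫ s in Ioi (0 : ℝ), s * Real.exp (-κ * (s - φ) ^ 2 / 2)) /
      (∫ s in Ioi (0 : ℝ), Real.exp (-κ * (s - φ) ^ 2 / 2)) = truncMean φ κ := by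
  rw [integral_mul_gaussWeight κ φ hκ, integral_gaussWeight κ φ hκ, truncMean, mills]
  have h1 := gaussMass_pos (√κ * φ)
  have h2 : 0 < √κ := Real.sqrt_pos.2 hκ
  have h3 : κ = √κ * √κ := (Real.mul_self_sqrt hκ.le).symm
  generalize gaussMass (√κ * φ) = G at *
  generalize Real.exp (-(√κ * φ) ^ 2 / 2) = E
  set r := √κ
  rw [h3]
  field_simp

theorem mills_pos (t : ℝ) : 0 < mills t := div_pos (Real.exp_pos _) (gaussMass_pos t)

theorem mills_mul_gaussMass (t : ℝ) : mills t * gaussMass t = Real.exp (-t ^ 2 / 2) :=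
  div_mul_cancel₀ _ (gaussMass_pos t).ne'

theorem hasDerivAt_mills (t : ℝ) : HasDerivAt mills (-(mills t * (t + mills t))) t := by
  have h1 : HasDerivAt (fun t : ℝ => Real.exp (-t ^ 2 / 2)) (Real.exp (-t ^ 2 / 2) * (-t)) t := by
    refine HasDerivAt.exp ?_
    refine (((hasDerivAt_id t).pow 2).neg.div_const 2).congr_deriv ?_
    simp
    ring
  refine (h1.div (hasDerivAt_gaussMass t) (gaussMass_pos t).ne').congr_deriv ?_
  have := gaussMass_pos t
  rw [mills]
  field_simp
  ring

theorem continuous_mills : Continuous mills :=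
  continuous_iff_continuousAt.2 fun t => (hasDerivAt_mills t).continuousAt

theorem contDiff_mills : ContDiff ℝ 1 mills := by
  rw [contDiff_one_iff_deriv]
  refine ⟨fun t => (hasDerivAt_mills t).differentiableAt, ?_⟩
  rw [show deriv mills = fun t => -(mills t * (t + mills t)) from
    funext fun t => (hasDerivAt_mills t).deriv]
  have := continuous_mills
  fun_prop

theorem mills_zero_sq : mills 0 ^ 2 = 2 / Real.pi := by
  rw [mills, gaussMass_zero, div_pow, Real.sq_sqrt (by positivity)]
  simp

/-- The derivative of the mean `t + mills t` of a Gaussian conditioned to be positive. -/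
def truncVar (t : ℝ) : ℝ := 1 - mills t * (t + mills t)

theorem hasDerivAt_add_mills (t : ℝ) : HasDerivAt (fun t => t + mills t) (truncVar t) t :=
  (hasDerivAt_id t).add (hasDerivAt_mills t)

theorem hasDerivAt_truncVar (t : ℝ) :
    HasDerivAt truncVar (mills t * ((t + mills t) * (t + 2 * mills t) - 1)) t := by
  refine (((hasDerivAt_mills t).mul (hasDerivAt_add_mills t)).const_sub 1).congr_deriv ?_
  rw [truncVar]
  ring

/-- Multiplied by `gaussMass`, this variance has derivative `h (t + h)² · gaussMass ≥ 0`, so its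
sign for `t ≥ 0` is settled at `t = 0`, where it equals `1 - 2/π`. -/
theorem truncVar_pos {t : ℝ} (ht : 0 ≤ t) : 0 < truncVar t := by
  have hd : ∀ t, HasDerivAt (fun t => truncVar t * gaussMass t)
      (mills t * (t + mills t) ^ 2 * gaussMass t) t := fun t => by
    refine ((hasDerivAt_truncVar t).mul (hasDerivAt_gaussMass t)).congr_deriv ?_
    rw [← mills_mul_gaussMass, truncVar]
    ring
  have hm : Monotone fun t => truncVar t * gaussMass t :=
    monotone_of_deriv_nonneg (fun t => (hd t).differentiableAt) fun t => by
      rw [(hd t).deriv]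
      have := mills_pos t
      have := gaussMass_pos t
      positivity
  have h0 : 0 < truncVar 0 * gaussMass 0 := by
    refine mul_pos ?_ (gaussMass_pos 0)
    rw [truncVar, zero_add, ← sq, mills_zero_sq, sub_pos, div_lt_one Real.pi_pos]
    linarith [Real.pi_gt_three]
  exact pos_of_mul_pos_left (h0.trans_le (hm ht)) (gaussMass_pos t).le

/-- The inverse Mills ratio is strictly convex on the half-line. -/
theorem add_mills_mul_add_two_mills_gt {t : ℝ} (ht : 0 ≤ t) :
    0 < (t + mills t) * (t + 2 * mills t) - 1 := by
  -- The factor `gaussMass / h²` is an integrating factor: it turns the derivative into the visibly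
  -- nonnegative `2 (t + h)³ · gaussMass / h²`. At `t = 0` the bracket is `2 h(0)² - 1 = 4/π - 1 >
  -- 0`.
  have hd : ∀ t, HasDerivAt
      (fun t => ((t + mills t) * (t + 2 * mills t) - 1) * gaussMass t / mills t ^ 2)
      (2 * (t + mills t) ^ 3 * gaussMass t / mills t ^ 2) t := fun t => by
    have hm := mills_pos t
    have h1 := (((hasDerivAt_add_mills t).mul
      ((hasDerivAt_id t).add ((hasDerivAt_mills t).const_mul 2))).sub_const 1)
    refine ((h1.mul (hasDerivAt_gaussMass t)).div ((hasDerivAt_mills t).pow 2)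
      (pow_pos hm 2).ne').congr_deriv ?_
    rw [← mills_mul_gaussMass, truncVar]
    simp only [id, Nat.cast_ofNat, Pi.mul_apply, Pi.add_apply, Pi.pow_apply]
    field_simp
    ring
  have hm : MonotoneOn (fun t => ((t + mills t) * (t + 2 * mills t) - 1) * gaussMass t /
      mills t ^ 2) (Ici 0) := by
    refine monotoneOn_of_deriv_nonneg (convex_Ici 0)
      (fun t _ => (hd t).continuousAt.continuousWithinAt)
      (fun t _ => (hd t).differentiableAt.differentiableWithinAt) fun t ht => ?_
    rw [interior_Ici, mem_Ioi] at ht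
    rw [(hd t).deriv]
    have := mills_pos t
    have := gaussMass_pos t
    positivity
  have h0 : 0 < ((0 + mills 0) * (0 + 2 * mills 0) - 1) * gaussMass 0 / mills 0 ^ 2 := by
    refine div_pos (mul_pos ?_ (gaussMass_pos 0)) (pow_pos (mills_pos 0) 2)
    have : (0 + mills 0) * (0 + 2 * mills 0) = 2 * mills 0 ^ 2 := by ring
    rw [this, mills_zero_sq, sub_pos, ← mul_div_assoc, one_lt_div Real.pi_pos]
    linarith [Real.pi_lt_d2]
  have h1 := h0.trans_le (hm self_mem_Ici ht ht)
  exact pos_of_mul_pos_left ((div_pos_iff_of_pos_right (pow_pos (mills_pos t) 2)).1 h1)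
    (gaussMass_pos t).le

theorem truncMean_pos {φ κ : ℝ} (hφ : 0 ≤ φ) (hκ : 0 < κ) : 0 < truncMean φ κ :=
  add_pos_of_nonneg_of_pos hφ (div_pos (mills_pos _) (Real.sqrt_pos.2 hκ))

theorem hasDerivAt_truncMean_left (hκ : 0 < κ) :
    HasDerivAt (fun φ => truncMean φ κ) (truncVar (√κ * φ)) φ := by
  have h1 : HasDerivAt (fun φ => √κ * φ) (√κ * 1) φ := (hasDerivAt_id φ).const_mul _
  refine ((hasDerivAt_id φ).add (((hasDerivAt_mills _).comp φ h1).div_const √κ)).congr_deriv ?_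
  have : 0 < √κ := Real.sqrt_pos.2 hκ
  rw [truncVar]
  field_simp
  ring

theorem truncMean_monotoneOn (hκ : 0 < κ) : MonotoneOn (fun φ => truncMean φ κ) (Ici 0) := by
  refine monotoneOn_of_deriv_nonneg (convex_Ici 0)
    (fun φ _ => (hasDerivAt_truncMean_left κ φ hκ).continuousAt.continuousWithinAt)
    (fun φ _ => (hasDerivAt_truncMean_left κ φ hκ).differentiableAt.differentiableWithinAt)
    fun φ hφ => ?_
  rw [interior_Ici, mem_Ioi] at hφ
  rw [(hasDerivAt_truncMean_left κ φ hκ).deriv]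
  exact (truncVar_pos (by positivity)).le

/-- The truncated variance in terms of the truncated mean. -/
theorem truncVar_eq (hκ : 0 < κ) :
    truncVar (√κ * φ) = 1 - κ * truncMean φ κ * (truncMean φ κ - φ) := by
  have h2 : 0 < √κ := Real.sqrt_pos.2 hκ
  have h3 : κ = √κ * √κ := (Real.mul_self_sqrt hκ.le).symm
  rw [truncVar, truncMean]
  set r := √κ
  rw [h3]
  field_simp
  ring

end TruncatedGaussian

/-! ### Cut-off and Hadamard averaging -/

section ScalarCalculus

/-- Multiplication by a bump function. It supplies the globally `C¹` function needed by the
superposition operator from regularity of `Φ` near one point only. -/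
theorem exists_contDiff_eventuallyEq {E : Type*} [NormedAddCommGroup E] [NormedSpace ℝ E]
    [FiniteDimensional ℝ E] {f : E → ℝ} {x : E} (hf : ContDiffAt ℝ 1 f x) :
    ∃ g : E → ℝ, ContDiff ℝ 1 g ∧ g =ᶠ[𝓝 x] f := by
  obtain ⟨ε, hε, h⟩ := Metric.eventually_nhds_iff.1 (hf.eventually (by simp))
  let b : ContDiffBump x := ⟨ε / 4, ε / 2, by positivity, by linarith⟩
  refine ⟨fun y => b y * f y, contDiff_iff_contDiffAt.2 fun y => ?_, ?_⟩
  · by_cases hy : dist y x < ε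
    · exact b.contDiffAt.mul (h hy)
    · have : (fun y => b y * f y) =ᶠ[𝓝 y] fun _ => 0 := by
        have h1 : ∀ᶠ z in 𝓝 y, ε / 2 < dist z x :=
          (continuous_id.dist continuous_const).tendsto y |>.eventually_const_lt
            (show ε / 2 < dist y x by linarith)
        filter_upwards [h1] with z hz
        rw [b.zero_of_le_dist hz.le, zero_mul]
      exact contDiffAt_const.congr_of_eventuallyEq this
  · filter_upwards [b.eventuallyEq_one] with y hy
    rw [hy, Pi.one_apply, one_mul]

theorem contDiff_one_intervalIntegral {E : Type*} [NormedAddCommGroup E] [NormedSpace ℝ E]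
    [ProperSpace E] (F : E → ℝ → ℝ) (F' : E → ℝ → E →L[ℝ] ℝ) (hF : Continuous F.uncurry)
    (hF' : Continuous F'.uncurry) (hd : ∀ x t, HasFDerivAt (fun x => F x t) (F' x t) x) (a b : ℝ) :
    ContDiff ℝ 1 fun x => ∫ t in a..b, F x t := by
  rw [contDiff_one_iff_hasFDerivAt]
  refine ⟨fun x => ∫ t in a..b, F' x t,
    intervalIntegral.continuous_parametric_intervalIntegral_of_continuous' hF' a b, fun x => ?_⟩
  obtain ⟨C, hC⟩ := ((isCompact_closedBall x 1).prod (isCompact_uIcc (a := a) (b := b))).exists_bound_of_continuousOn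
    hF'.continuousOn
  refine intervalIntegral.hasFDerivAt_integral_of_dominated_of_fderiv_le (bound := fun _ => C)
    (Metric.ball_mem_nhds x one_pos) (Eventually.of_forall fun y => ?_) ?_ ?_
    (Eventually.of_forall fun t ht y hy => ?_) intervalIntegrable_const
    (Eventually.of_forall fun t _ y _ => hd y t)
  · exact (hF.comp (by fun_prop : Continuous fun t : ℝ => (y, t))).aestronglyMeasurable
  · exact (hF.comp (by fun_prop : Continuous fun t : ℝ => (x, t))).intervalIntegrable _ _
  · exact (hF'.comp (by fun_prop : Continuous fun t : ℝ => (x, t))).aestronglyMeasurable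
  · exact hC (y, t) ⟨Metric.ball_subset_closedBall hy, uIoc_subset_uIcc ht⟩

/-- Hadamard's lemma: the average of a `C¹` function over segments is `C¹`. -/
theorem contDiff_average (q : ℝ × ℝ → ℝ) (hq : ContDiff ℝ 1 q) :
    ContDiff ℝ 1 fun p : ℝ × ℝ => ∫ σ in (0 : ℝ)..1, q (σ * p.1, p.2) := by
  have hc := hq.continuous_fderiv one_ne_zero
  let A : ℝ → ℝ × ℝ →L[ℝ] ℝ × ℝ := fun σ =>
    (σ • ContinuousLinearMap.fst ℝ ℝ ℝ).prod (ContinuousLinearMap.snd ℝ ℝ ℝ)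
  have hA : Continuous A := by
    have : A = fun σ => σ • (ContinuousLinearMap.inl ℝ ℝ ℝ ∘L ContinuousLinearMap.fst ℝ ℝ ℝ) +
        ContinuousLinearMap.inr ℝ ℝ ℝ ∘L ContinuousLinearMap.snd ℝ ℝ ℝ := by
      funext σ
      ext <;> simp [A]
    rw [this]
    fun_prop
  refine contDiff_one_intervalIntegral (fun p σ => q (σ * p.1, p.2))
    (fun p σ => (fderiv ℝ q (σ * p.1, p.2)).comp (A σ)) ?_ ?_ ?_ 0 1
  · exact hq.continuous.comp (by fun_prop)
  · exact (hc.comp (by fun_prop : Continuous fun z : (ℝ × ℝ) × ℝ => (z.2 * z.1.1, z.1.2))).clm_comp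
      (hA.comp continuous_snd)
  · intro p σ
    exact ((hq.differentiable one_ne_zero) _).hasFDerivAt.comp p (A σ).hasFDerivAt

end ScalarCalculus

/-! ### The scalar response and its homogeneous fixed point -/

section Response

variable (Φ : ℝ → ℝ) (D : ℝ)

/-- The mean response `L⁻ᵈ M(Φ s, κ)` to the input `s`, with `D = Lᵈ`. -/
def response (s κ : ℝ) : ℝ := truncMean (Φ s) κ / D

/-- The derivative of the mean response in the input. -/
def responseDeriv (s κ : ℝ) : ℝ := truncVar (√κ * Φ s) * deriv Φ s / D

variable {Φ D}

theorem contDiffAt_truncMean {φ κ : ℝ} (hκ : 0 < κ) :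
    ContDiffAt ℝ 1 (fun p : ℝ × ℝ => truncMean p.1 p.2) (φ, κ) := by
  unfold truncMean
  have h1 : ContDiffAt ℝ 1 (fun p : ℝ × ℝ => √p.2) (φ, κ) := contDiffAt_snd.sqrt hκ.ne'
  exact contDiffAt_fst.add ((contDiff_mills.contDiffAt.comp _ (h1.mul contDiffAt_fst)).div h1
    (Real.sqrt_pos.2 hκ).ne')

theorem contDiffAt_response {s κ : ℝ} (hΦ : ContDiffAt ℝ 1 Φ s) (hκ : 0 < κ) :
    ContDiffAt ℝ 1 (fun p : ℝ × ℝ => response Φ D p.1 p.2) (s, κ) := by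
  have h : ContDiffAt ℝ 1 (fun p : ℝ × ℝ => (Φ p.1, p.2)) (s, κ) :=
    (ContDiffAt.comp (s, κ) hΦ contDiffAt_fst).prodMk contDiffAt_snd
  have h2 := ContDiffAt.comp (s, κ) (contDiffAt_truncMean (φ := Φ s) hκ) h
  exact h2.div_const D

theorem hasDerivAt_response {s κ : ℝ} (hΦ : DifferentiableAt ℝ Φ s) (hκ : 0 < κ) :
    HasDerivAt (fun s => response Φ D s κ) (responseDeriv Φ D s κ) s :=
  ((hasDerivAt_truncMean_left κ (Φ s) hκ).comp s hΦ.hasDerivAt).div_const D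

theorem contDiffAt_responseDeriv {s κ : ℝ} (hΦ : ContDiffAt ℝ 2 Φ s) (hκ : 0 < κ) :
    ContDiffAt ℝ 1 (fun p : ℝ × ℝ => responseDeriv Φ D p.1 p.2) (s, κ) := by
  have h1 : ContDiffAt ℝ 1 (fun p : ℝ × ℝ => √p.2) (s, κ) := contDiffAt_snd.sqrt hκ.ne'
  have h2 : ContDiffAt ℝ 1 (fun p : ℝ × ℝ => Φ p.1) (s, κ) :=
    ContDiffAt.comp (s, κ) (hΦ.of_le one_le_two) contDiffAt_fst
  have h3 : ContDiffAt ℝ 1 (fun p : ℝ × ℝ => deriv Φ p.1) (s, κ) :=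
    ContDiffAt.comp (s, κ) (hΦ.derivWithin (by norm_num)) contDiffAt_fst
  have h4 : ContDiff ℝ 1 truncVar := by
    unfold truncVar
    have := contDiff_mills
    fun_prop
  exact ((h4.contDiffAt.comp _ (h1.mul h2)).mul h3).div_const D

theorem continuous_response (hΦ : Continuous Φ) (κ : ℝ) : Continuous fun s => response Φ D s κ := by
  unfold response truncMean
  have := continuous_mills
  fun_prop

theorem response_monotone (hm : Monotone Φ) (hnn : ∀ s, 0 ≤ Φ s) (hD : 0 < D) {κ : ℝ}
    (hκ : 0 < κ) : Monotone fun s => response Φ D s κ := fun s t hst =>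
  div_le_div_of_nonneg_right (truncMean_monotoneOn κ hκ (hnn s) (hnn t) (hm hst)) hD.le

/-- As `w < 0`, the right-hand side is nonincreasing in `r`, so the difference of the two sides is
strictly increasing. It is nonpositive at `0` and nonnegative at `R`, the value of the right-hand
side at `r = 0`. -/
theorem existsUnique_response_fixedPoint (hc : Continuous Φ) (hm : Monotone Φ)
    (hnn : ∀ s, 0 ≤ Φ s) (hD : 0 < D) {κ : ℝ} (hκ : 0 < κ) {w : ℝ} (hw : w < 0) (B : ℝ) :
    ∃! r : ℝ, r = response Φ D (w * r + B) κ := by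
  set f : ℝ → ℝ := fun r => r - response Φ D (w * r + B) κ with hf
  have hfc : Continuous f := by
    have := continuous_response (D := D) hc κ
    fun_prop
  have hmono : StrictMono f := fun a b hab => by
    have h1 : w * b + B ≤ w * a + B := by nlinarith
    have h2 := response_monotone hm hnn hD hκ h1
    simp only [hf] at h2 ⊢
    linarith
  have hpos : ∀ s, 0 < response Φ D s κ := fun s => div_pos (truncMean_pos (hnn s) hκ) hD
  set R := response Φ D (w * 0 + B) κ
  have hR : 0 < R := hpos _
  have h0 : f 0 ≤ 0 := by simp only [hf, zero_sub]; exact neg_nonpos.2 (hpos _).le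
  have h1 : 0 ≤ f R := by
    have h2 : w * R + B ≤ w * 0 + B := by nlinarith
    have h3 := response_monotone hm hnn hD hκ h2
    exact sub_nonneg.2 h3
  obtain ⟨r, -, hr⟩ := intermediate_value_Icc hR.le hfc.continuousOn ⟨h0, h1⟩
  refine ⟨r, sub_eq_zero.1 hr, fun r' hr' => hmono.injective ?_⟩
  rw [hr]
  exact sub_eq_zero.2 hr'

variable {w B : ℝ} {r : ℝ → ℝ} {κ₀ : ℝ}

/-- The partial derivative in `x` of `x - response` is `1 - w · responseDeriv ≥ 1`, so the implicit
function theorem applies; uniqueness of the fixed point identifies the implicit function with `r`.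
-/
theorem contDiffAt_fixedPoint (hm : Monotone Φ)
    (hnn : ∀ s, 0 ≤ Φ s) (hD : 0 < D) (hw : w < 0)
    (hr : ∀ κ > 0, ∀ x, x = response Φ D (w * x + B) κ ↔ x = r κ) (hκ₀ : 0 < κ₀)
    (hΦ : ContDiffAt ℝ 1 Φ (w * r κ₀ + B)) : ContDiffAt ℝ 1 r κ₀ := by
  let f : ℝ × ℝ → ℝ := fun p => p.2 - response Φ D (w * p.2 + B) p.1
  have hf : ContDiffAt ℝ 1 f (κ₀, r κ₀) := by
    have h1 : ContDiffAt ℝ 1 (fun p : ℝ × ℝ => (w * p.2 + B, p.1)) (κ₀, r κ₀) := by fun_prop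
    have h2 := ContDiffAt.comp (κ₀, r κ₀) (contDiffAt_response (D := D) hΦ hκ₀) h1
    exact contDiffAt_snd.sub h2
  have hd : HasDerivAt (fun x => f (κ₀, x))
      (1 - responseDeriv Φ D (w * r κ₀ + B) κ₀ * (w * 1)) (r κ₀) :=
    (hasDerivAt_id _).sub (HasDerivAt.comp (h₂ := fun s => response Φ D s κ₀) (r κ₀)
      (hasDerivAt_response (hΦ.differentiableAt one_ne_zero) hκ₀)
      (((hasDerivAt_id (r κ₀)).const_mul w).add_const B))
  have hd' : HasFDerivAt (fun x => f (κ₀, x))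
      (fderiv ℝ f (κ₀, r κ₀) ∘L .inr ℝ ℝ ℝ) (r κ₀) := by
    have h1 : HasFDerivAt f (fderiv ℝ f (κ₀, r κ₀)) ((fun x : ℝ => (κ₀, x)) (r κ₀)) :=
      (hf.differentiableAt one_ne_zero).hasFDerivAt
    exact h1.comp _ (hasFDerivAt_prodMk_right κ₀ (r κ₀))
  have hpos : 0 < 1 - responseDeriv Φ D (w * r κ₀ + B) κ₀ * (w * 1) := by
    have h1 : 0 ≤ responseDeriv Φ D (w * r κ₀ + B) κ₀ :=
      div_nonneg (mul_nonneg (truncVar_pos (mul_nonneg (Real.sqrt_nonneg _) (hnn _))).le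
        hm.deriv_nonneg) hD.le
    nlinarith
  have hinv : (fderiv ℝ f (κ₀, r κ₀) ∘L .inr ℝ ℝ ℝ).IsInvertible := by
    rw [hd'.unique hd.hasFDerivAt]
    refine ⟨ContinuousLinearEquiv.unitsEquivAut ℝ (Units.mk0 _ hpos.ne'), ?_⟩
    ext
    simp
  have h1 := hf.contDiffAt_implicitFunction one_ne_zero hinv
  refine h1.congr_of_eventuallyEq ?_
  filter_upwards [hf.eventually_apply_implicitFunction one_ne_zero hinv, lt_mem_nhds hκ₀] with κ h2 h3
  have h4 : f (κ₀, r κ₀) = 0 := sub_eq_zero.2 ((hr κ₀ hκ₀ _).2 rfl)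
  rw [h4] at h2
  exact ((hr κ h3 _).1 (sub_eq_zero.1 h2)).symm

/-- For a fixed centre the truncated mean strictly decreases in `κ`, and the feedback through `w <
0` multiplies `r'` by a positive factor. -/
theorem deriv_fixedPoint_neg (hm : Monotone Φ)
    (hnn : ∀ s, 0 ≤ Φ s) (hD : 0 < D) (hw : w < 0)
    (hr : ∀ κ > 0, r κ = response Φ D (w * r κ + B) κ) (hκ₀ : 0 < κ₀) {r' : ℝ}
    (hr' : HasDerivAt r r' κ₀) (hΦ : DifferentiableAt ℝ Φ (w * r κ₀ + B)) : r' < 0 := by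
  set y := w * r κ₀ + B with hy
  have h0 : 0 < √κ₀ := Real.sqrt_pos.2 hκ₀
  have h1 : HasDerivAt (fun κ => w * r κ + B) (w * r') κ₀ := (hr'.const_mul w).add_const B
  have h2 : HasDerivAt (fun κ => Φ (w * r κ + B)) (deriv Φ y * (w * r')) κ₀ :=
    (show HasDerivAt Φ (deriv Φ y) ((fun κ => w * r κ + B) κ₀) from hΦ.hasDerivAt).comp κ₀ h1
  have hs : HasDerivAt (fun κ => √κ) (1 / (2 * √κ₀)) κ₀ := Real.hasDerivAt_sqrt hκ₀.ne'
  have h3 := hs.mul h2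
  have h4 := (h2.add (((hasDerivAt_mills _).comp κ₀ h3).div hs h0.ne')).div_const D
  have h5 : r =ᶠ[𝓝 κ₀] fun κ => response Φ D (w * r κ + B) κ := by
    filter_upwards [lt_mem_nhds hκ₀] with κ hκ
    exact hr κ hκ
  have h6 := hr'.unique (h4.congr_of_eventuallyEq h5)
  simp only [Function.comp, Pi.mul_apply] at h6
  rw [← hy] at h6
  have hv := truncVar_pos (mul_nonneg h0.le (hnn y))
  have hH := mills_pos (√κ₀ * Φ y)
  have hΦ0 := hnn y
  have hd : 0 ≤ deriv Φ y := hm.deriv_nonneg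
  rw [truncVar] at hv
  generalize mills (√κ₀ * Φ y) = H at *
  set φ := Φ y
  set Φ' := deriv Φ y
  set σ := √κ₀
  have h7 : r' * (D - Φ' * w * (1 - H * (σ * φ + H))) =
      -(H * (σ * φ + H) * φ / (2 * σ ^ 2) + H / (2 * σ ^ 3)) := by
    rw [eq_div_iff hD.ne'] at h6
    rw [mul_sub, h6]
    field_simp
    ring
  have h8 : 0 < H * (σ * φ + H) * φ / (2 * σ ^ 2) + H / (2 * σ ^ 3) := by positivity
  have h9 : 0 < D - Φ' * w * (1 - H * (σ * φ + H)) := by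
    have : Φ' * w * (1 - H * (σ * φ + H)) ≤ 0 :=
      mul_nonpos_of_nonpos_of_nonneg (mul_nonpos_of_nonneg_of_nonpos hd hw.le) hv.le
    linarith
  by_contra hcon
  have := mul_nonneg (not_lt.1 hcon) h9.le
  linarith

/-- Along the homogeneous branch the slope of the response strictly increases. -/
theorem exists_hasDerivAt_responseDeriv (hm : Monotone Φ)
    (hnn : ∀ s, 0 ≤ Φ s) (hD : 0 < D) (hw : w < 0)
    (hr : ∀ κ > 0, r κ = response Φ D (w * r κ + B) κ) (hκ₀ : 0 < κ₀) {r' : ℝ}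
    (hr' : HasDerivAt r r' κ₀) (hΦ : ContDiffAt ℝ 2 Φ (w * r κ₀ + B))
    (hΦ' : deriv Φ (w * r κ₀ + B) ≠ 0) (hΦ'' : 0 ≤ deriv (deriv Φ) (w * r κ₀ + B)) :
    ∃ a > 0, HasDerivAt (fun κ => responseDeriv Φ D (w * r κ + B) κ) a κ₀ := by
  have hneg := deriv_fixedPoint_neg hm hnn hD hw hr hκ₀ hr' (hΦ.differentiableAt two_ne_zero)
  set y := w * r κ₀ + B with hy
  have h0 : 0 < √κ₀ := Real.sqrt_pos.2 hκ₀
  have h1 : HasDerivAt (fun κ => w * r κ + B) (w * r') κ₀ := (hr'.const_mul w).add_const B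
  have h2 : HasDerivAt (fun κ => Φ (w * r κ + B)) (deriv Φ y * (w * r')) κ₀ :=
    (show HasDerivAt Φ (deriv Φ y) ((fun κ => w * r κ + B) κ₀) from
      (hΦ.differentiableAt two_ne_zero).hasDerivAt).comp κ₀ h1
  have h3 : HasDerivAt (fun κ => deriv Φ (w * r κ + B)) (deriv (deriv Φ) y * (w * r')) κ₀ :=
    HasDerivAt.comp (h₂ := deriv Φ) κ₀
      ((hΦ.derivWithin (m := 1) (by norm_num)).differentiableAt one_ne_zero).hasDerivAt h1
  have h4 := (Real.hasDerivAt_sqrt hκ₀.ne').mul h2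
  have h5 := (((hasDerivAt_truncVar _).comp κ₀ h4).mul h3).div_const D
  refine ⟨_, ?_, h5⟩
  simp only [Function.comp, Pi.mul_apply]
  rw [← hy]
  have hd : 0 < deriv Φ y := lt_of_le_of_ne hm.deriv_nonneg (Ne.symm hΦ')
  have hy' : 0 < w * r' := mul_pos_of_neg_of_neg hw hneg
  have hΦ0 := hnn y
  have ht : 0 ≤ √κ₀ * Φ y := mul_nonneg h0.le hΦ0
  have hv := truncVar_pos ht
  have hq := add_mills_mul_add_two_mills_gt ht
  have hH := mills_pos (√κ₀ * Φ y)
  positivity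

/-- Near a point of the homogeneous branch the increments of the response are `g (t, κ) * t` with
`g` of class `C¹`. -/
theorem exists_response_slope (hm : Monotone Φ)
    (hnn : ∀ s, 0 ≤ Φ s) (hD : 0 < D) (hw : w < 0)
    (hr : ∀ κ > 0, ∀ x, x = response Φ D (w * x + B) κ ↔ x = r κ) (hκ₀ : 0 < κ₀)
    (hΦ : ContDiffAt ℝ 2 Φ (w * r κ₀ + B))
    (hΦ' : deriv Φ (w * r κ₀ + B) ≠ 0) (hΦ'' : 0 ≤ deriv (deriv Φ) (w * r κ₀ + B)) :
    ∃ g : C(ℝ × ℝ, ℝ), ContDiff ℝ 1 g ∧ g (0, κ₀) = responseDeriv Φ D (w * r κ₀ + B) κ₀ ∧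
      (∃ a > 0, HasDerivAt (fun κ => g (0, κ)) a κ₀) ∧
      ∀ᶠ q in 𝓝 ((0 : ℝ), κ₀), g q * q.1 =
        response Φ D (w * r q.2 + B + q.1) q.2 - response Φ D (w * r q.2 + B) q.2 := by
  have hrC := contDiffAt_fixedPoint hm hnn hD hw hr hκ₀ (hΦ.of_le one_le_two)
  have hr' := (hrC.differentiableAt one_ne_zero).hasDerivAt
  obtain ⟨a, ha, haD⟩ := exists_hasDerivAt_responseDeriv hm hnn hD hw
    (fun κ hκ => (hr κ hκ _).2 rfl) hκ₀ hr' hΦ hΦ' hΦ''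
  let q₀ : ℝ × ℝ → ℝ := fun p => responseDeriv Φ D (w * r p.2 + B + p.1) p.2
  have hin : ContDiffAt ℝ 1 (fun p : ℝ × ℝ => (w * r p.2 + B + p.1, p.2)) (0, κ₀) := by
    have h1 : ContDiffAt ℝ 1 (fun p : ℝ × ℝ => r p.2) (0, κ₀) :=
      ContDiffAt.comp (0, κ₀) hrC contDiffAt_snd
    fun_prop
  have hq₀ : ContDiffAt ℝ 1 q₀ (0, κ₀) := by
    have h1 : (fun p : ℝ × ℝ => (w * r p.2 + B + p.1, p.2)) (0, κ₀) = (w * r κ₀ + B, κ₀) := by simp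
    have h2 := contDiffAt_responseDeriv (D := D) hΦ hκ₀
    rw [← h1] at h2
    exact ContDiffAt.comp (0, κ₀) h2 hin
  -- The slope `g(t, κ)` is the average of this extended derivative over the segment from `(0, κ)`
  -- to `(t, κ)`; in the max metric the segment stays in the ball where `q` and `q₀` agree.
  obtain ⟨q, hq, hqe⟩ := exists_contDiff_eventuallyEq hq₀
  have hgC := contDiff_average q hq
  have hg0 : ∀ κ, ∫ σ in (0 : ℝ)..1, q (σ * ((0 : ℝ), κ).1, ((0 : ℝ), κ).2) = q (0, κ) := fun κ => by
    simp
  have hg0' : ∀ᶠ κ in 𝓝 κ₀, q (0, κ) = responseDeriv Φ D (w * r κ + B) κ := by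
    have : Tendsto (fun κ : ℝ => ((0 : ℝ), κ)) (𝓝 κ₀) (𝓝 (0, κ₀)) :=
      (by fun_prop : Continuous fun κ : ℝ => ((0 : ℝ), κ)).tendsto κ₀
    filter_upwards [this.eventually hqe] with κ hκ
    simpa [q₀] using hκ
  refine ⟨⟨_, hgC.continuous⟩, hgC, ?_, ⟨a, ha, ?_⟩, ?_⟩
  · exact (hg0 κ₀).trans hg0'.self_of_nhds
  · refine haD.congr_of_eventuallyEq ?_
    filter_upwards [hg0'] with κ hκ
    exact (hg0 κ).trans hκ
  have hdiff : ∀ᶠ p in 𝓝 ((0 : ℝ), κ₀), DifferentiableAt ℝ Φ (w * r p.2 + B + p.1) := by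
    have h1 : ∀ᶠ s in 𝓝 (w * r κ₀ + B), DifferentiableAt ℝ Φ s :=
      (hΦ.eventually (by simp)).mono fun s hs => hs.differentiableAt two_ne_zero
    have h2 : Tendsto (fun p : ℝ × ℝ => w * r p.2 + B + p.1) (𝓝 (0, κ₀)) (𝓝 (w * r κ₀ + B)) := by
      simpa using hin.continuousAt.fst.tendsto
    exact h2.eventually h1
  have hpos : ∀ᶠ p in 𝓝 ((0 : ℝ), κ₀), 0 < p.2 :=
    (continuous_snd.tendsto ((0 : ℝ), κ₀)).eventually (lt_mem_nhds hκ₀)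
  obtain ⟨ε, hε, hball⟩ := Metric.eventually_nhds_iff.1 (hqe.and (hdiff.and hpos))
  filter_upwards [Metric.ball_mem_nhds ((0 : ℝ), κ₀) hε] with p hp
  obtain ⟨t, κ⟩ := p
  rw [Metric.mem_ball, Prod.dist_eq] at hp
  have hseg : ∀ σ ∈ uIcc (0 : ℝ) 1, dist (σ * t, κ) ((0 : ℝ), κ₀) < ε := fun σ hσ => by
    rw [uIcc_of_le zero_le_one] at hσ
    refine lt_of_le_of_lt ?_ hp
    rw [Prod.dist_eq]
    refine max_le_max ?_ le_rfl
    simp only [dist_zero_right, norm_mul, Real.norm_eq_abs, abs_of_nonneg hσ.1]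
    exact mul_le_of_le_one_left (abs_nonneg t) hσ.2
  have hder : ∀ σ ∈ uIcc (0 : ℝ) 1, HasDerivAt (fun σ => response Φ D (w * r κ + B + σ * t) κ)
      (q (σ * t, κ) * t) σ := fun σ hσ => by
    obtain ⟨h1, h2, h3⟩ := hball (hseg σ hσ)
    rw [h1]
    have h4 : HasDerivAt (fun σ => w * r κ + B + σ * t) (1 * t) σ :=
      ((hasDerivAt_id σ).mul_const t).const_add _
    have h5 := (show HasDerivAt (fun s => response Φ D s κ) _ ((fun σ => w * r κ + B + σ * t) σ) from
      hasDerivAt_response (D := D) h2 h3).comp σ h4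
    rw [one_mul] at h5
    exact h5
  have hint := intervalIntegral.integral_eq_sub_of_hasDerivAt hder
    (((hq.continuous.comp (by fun_prop : Continuous fun σ : ℝ => (σ * t, κ))).mul
      continuous_const).intervalIntegrable _ _)
  rw [intervalIntegral.integral_mul_const] at hint
  simpa using hint

end Response

/-! ### Compactness of operators with a continuous kernel -/

section KernelOperator

variable {X : Type*} [TopologicalSpace X] [CompactSpace X]
  {H : Type*} [NormedAddCommGroup H] [InnerProductSpace ℝ H]

/-- The operator `u ↦ (x ↦ ⟪k x, u⟫)` of a continuous Hilbert space valued kernel. -/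
def kernelOp (k : C(X, H)) : H →L[ℝ] C(X, ℝ) :=
  LinearMap.mkContinuous
    { toFun := fun u => ⟨fun x => ⟪k x, u⟫_ℝ, by fun_prop⟩
      map_add' := fun u v => by ext x; simp [inner_add_right]
      map_smul' := fun c u => by ext x; simp [inner_smul_right] } ‖k‖ fun u => by
    rw [ContinuousMap.norm_le _ (by positivity)]
    intro x
    exact (norm_inner_le_norm _ _).trans
      (mul_le_mul_of_nonneg_right (k.norm_coe_le_norm x) (norm_nonneg u))

theorem kernelOp_apply (k : C(X, H)) (u : H) (x : X) : kernelOp k u x = ⟪k x, u⟫_ℝ := rfl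

/-- Arzelà–Ascoli: the image of the unit ball is bounded by `‖k‖`, and it is equicontinuous because
`|⟪k x - k y, u⟫| ≤ ‖k x - k y‖`. -/
theorem isCompactOperator_kernelOp (k : C(X, H)) : IsCompactOperator (kernelOp k) := by
  let J := ContinuousMap.linearIsometryBoundedOfCompact X ℝ ℝ
  let K : H →L[ℝ] BoundedContinuousFunction X ℝ :=
    (J.toContinuousLinearEquiv : C(X, ℝ) →L[ℝ] BoundedContinuousFunction X ℝ) ∘L kernelOp k
  have hKa : ∀ u x, K u x = ⟪k x, u⟫_ℝ := fun u x => rfl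
  have hK : IsCompactOperator K := by
    refine (isCompactOperator_iff_isCompact_closure_image_closedBall
      (K : H →ₗ[ℝ] BoundedContinuousFunction X ℝ) one_pos).2 ?_
    refine BoundedContinuousFunction.arzela_ascoli (Metric.closedBall 0 ‖k‖)
      (isCompact_closedBall _ _) _ ?_ ?_
    · rintro _ x ⟨u, hu, rfl⟩
      rw [mem_closedBall_zero_iff] at hu ⊢
      refine (norm_inner_le_norm (𝕜 := ℝ) (k x) u).trans ?_
      exact (mul_le_mul (k.norm_coe_le_norm x) hu (norm_nonneg u) (norm_nonneg k)).trans
        (mul_one _).le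
    · intro x
      rw [Metric.equicontinuousAt_iff_right]
      intro ε hε
      have h1 := Metric.tendsto_nhds.1 (k.continuous.tendsto x) ε hε
      filter_upwards [h1] with y hy
      rintro ⟨_, u, hu, rfl⟩
      rw [mem_closedBall_zero_iff] at hu
      change dist ⟪k x, u⟫_ℝ ⟪k y, u⟫_ℝ < ε
      rw [dist_eq_norm, ← inner_sub_left]
      refine (norm_inner_le_norm _ _).trans_lt ?_
      rw [← dist_eq_norm, dist_comm]
      exact (mul_le_of_le_one_right dist_nonneg hu).trans_lt hy
  have h2 := hK.clm_comp
    (J.symm.toContinuousLinearEquiv : BoundedContinuousFunction X ℝ →L[ℝ] C(X, ℝ))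
  have h3 : (kernelOp k : H → C(X, ℝ)) =
      (J.symm.toContinuousLinearEquiv : BoundedContinuousFunction X ℝ →L[ℝ] C(X, ℝ)) ∘ K := by
    funext u
    rfl
  rw [h3]
  exact h2

end KernelOperator

variable {d : ℕ} {L : ℝ} [Fact (0 < L)]

/-! ### Invariance under endomorphisms of the torus -/

section Automorphisms

/-- A surjective continuous homomorphism pushes Haar measure to a Haar measure of the same total
mass. -/
theorem measurePreserving_automorphism (S : Torus d L →ₜ+ Torus d L) (hS : Function.Surjective S) :
    MeasurePreserving S (volume : Measure (Torus d L)) volume :=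
  AddMonoidHom.measurePreserving (f := (S : Torus d L →+ Torus d L)) S.continuous_toFun hS rfl

instance : (volume : Measure (Torus d L)).IsNegInvariant :=
  ⟨(AddMonoidHom.measurePreserving (f := negAddMonoidHom (α := Torus d L)) continuous_neg
    neg_surjective rfl).map_eq⟩

/-- Composition with a surjective continuous endomorphism of the torus. -/
def pullback (S : Torus d L →ₜ+ Torus d L) (hS : Function.Surjective S) : L2 d L →ₗᵢ[ℝ] L2 d L :=
  Lp.compMeasurePreservingₗᵢ ℝ S (measurePreserving_automorphism S hS)

theorem coeFn_pullback (S : Torus d L →ₜ+ Torus d L) (hS : Function.Surjective S) (u : L2 d L) :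
    pullback S hS u =ᵐ[volume] u ∘ S :=
  Lp.coeFn_compMeasurePreserving u (measurePreserving_automorphism S hS)

theorem pullback_eq_iff (S : Torus d L →ₜ+ Torus d L) (hS : Function.Surjective S) (u : L2 d L) :
    pullback S hS u = u ↔ u ∘ S =ᵐ[volume] u := by
  rw [Lp.ext_iff]
  exact ⟨fun h => (coeFn_pullback S hS u).symm.trans h, fun h => (coeFn_pullback S hS u).trans h⟩

theorem coeFn_toL2 (f : C(Torus d L, ℝ)) : toL2 f =ᵐ[volume] f := ContinuousMap.coeFn_toLp _ _

theorem pullback_toL2 (S : Torus d L →ₜ+ Torus d L) (hS : Function.Surjective S)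
    (f : C(Torus d L, ℝ)) (hf : ∀ x, f (S x) = f x) : pullback S hS (toL2 f) = toL2 f := by
  rw [pullback_eq_iff]
  filter_upwards [coeFn_toL2 f,
    (measurePreserving_automorphism S hS).quasiMeasurePreserving.ae (coeFn_toL2 f)] with x h1 h2
  rw [Function.comp, h1, h2, hf]

/-- The functions in `L²` that are invariant under a family of automorphisms. -/
def invariants {I : Type*} (S : I → (Torus d L →ₜ+ Torus d L))
    (hS : ∀ i, Function.Surjective (S i)) : Submodule ℝ (L2 d L) where
  carrier := {u | ∀ i, pullback (S i) (hS i) u = u}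
  add_mem' := fun {u v} hu hv i => by rw [map_add, hu i, hv i]
  zero_mem' := fun i => map_zero _
  smul_mem' := fun c u hu i => by rw [map_smul, hu i]

theorem mem_invariants {I : Type*} {S : I → (Torus d L →ₜ+ Torus d L)}
    {hS : ∀ i, Function.Surjective (S i)} {u : L2 d L} :
    u ∈ invariants S hS ↔ ∀ i, pullback (S i) (hS i) u = u := Iff.rfl

instance {I : Type*} (S : I → (Torus d L →ₜ+ Torus d L))
    (hS : ∀ i, Function.Surjective (S i)) : CompleteSpace (invariants S hS) := by
  have h : (invariants S hS : Set (L2 d L)) = ⋂ i, {u | pullback (S i) (hS i) u = u} := by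
    ext u
    simp [mem_invariants]
  have hc : IsClosed (invariants S hS : Set (L2 d L)) := by
    rw [h]
    exact isClosed_iInter fun i => isClosed_eq (pullback (S i) (hS i)).continuous continuous_id
  exact hc.isComplete.completeSpace_coe

end Automorphisms

/-! ### Convolution as a compact symmetric operator -/

section Convolution

theorem measurePreserving_sub_left_torus (x : Torus d L) :
    MeasurePreserving (fun y => x - y) (volume : Measure (Torus d L)) volume :=
  Measure.measurePreserving_sub_left volume x

/-- The kernel `x ↦ W (x - ·)` as a continuous function into `L²`. -/
def convKernel (W : L2 d L) : C(Torus d L, L2 d L) where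
  toFun x := Lp.compMeasurePreserving (fun y => x - y) (measurePreserving_sub_left_torus x) W
  continuous_toFun := by
    let g : C(Torus d L, C(Torus d L, Torus d L)) :=
      (ContinuousMap.mk (fun p : Torus d L × Torus d L => p.1 - p.2) (by fun_prop)).curry
    exact Continuous.compMeasurePreservingLp (g := g) continuous_const g.continuous
      measurePreserving_sub_left_torus (by norm_num)

/-- The convolution `u ↦ W * u` from `L²` to the continuous functions. -/
def convOp (W : L2 d L) : L2 d L →L[ℝ] C(Torus d L, ℝ) := kernelOp (convKernel W)

theorem coeFn_convKernel (W : L2 d L) (x : Torus d L) :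
    convKernel W x =ᵐ[volume] fun y => W (x - y) :=
  Lp.coeFn_compMeasurePreserving W (measurePreserving_sub_left_torus x)

theorem inner_eq_integral (u v : L2 d L) : ⟪u, v⟫_ℝ = ∫ x, u x * v x := by
  rw [L2.inner_def]
  refine integral_congr_ae (Eventually.of_forall fun x => ?_)
  simp [mul_comm]

theorem inner_toL2 (u : L2 d L) (f : C(Torus d L, ℝ)) : ⟪u, toL2 f⟫_ℝ = ∫ x, u x * f x := by
  rw [inner_eq_integral]
  refine integral_congr_ae ?_
  filter_upwards [coeFn_toL2 f] with x hx
  rw [hx]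

theorem convOp_apply (W u : L2 d L) (x : Torus d L) : convOp W u x = conv W u x := by
  rw [convOp, kernelOp_apply, inner_eq_integral, conv]
  refine integral_congr_ae ?_
  filter_upwards [coeFn_convKernel W x] with y hy
  rw [hy]

theorem convOp_toL2 (W : L2 d L) (f : C(Torus d L, ℝ)) (x : Torus d L) :
    convOp W (toL2 f) x = ∫ y, W y * f (x - y) := by
  rw [convOp, kernelOp_apply, inner_toL2,
    ← integral_sub_left_eq_self (fun y => W y * f (x - y)) volume x]
  refine integral_congr_ae ?_
  filter_upwards [coeFn_convKernel W x] with y hy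
  rw [hy, sub_sub_cancel]

theorem convOp_comp (S : Torus d L →ₜ+ Torus d L) (hS : Function.Surjective S) {W u : L2 d L}
    (hW : pullback S hS W = W) (hu : pullback S hS u = u) (x : Torus d L) :
    convOp W u (S x) = convOp W u x := by
  have h : pullback S hS (convKernel W (S x)) = convKernel W x := by
    rw [Lp.ext_iff]
    have h1 := (measurePreserving_automorphism S hS).quasiMeasurePreserving.ae
      (coeFn_convKernel W (S x))
    have h2 := (measurePreserving_sub_left_torus x).quasiMeasurePreserving.ae
      ((pullback_eq_iff S hS W).1 hW)
    filter_upwards [h1, h2, coeFn_pullback S hS (convKernel W (S x)), coeFn_convKernel W x]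
      with y h1 h2 h3 h4
    rw [h3, h4, Function.comp, h1, ← h2, Function.comp, map_sub]
  rw [convOp, kernelOp_apply, kernelOp_apply, ← h]
  conv_rhs => rw [← hu]
  rw [LinearIsometry.inner_map_map]

theorem integrable_L2 (u : L2 d L) : Integrable u :=
  (Lp.memLp u).integrable one_le_two

/-- Fubini together with `W(-x) = W(x)`. By density `v` may be taken continuous, so that the double
integrand is an integrable convolution integrand times a bounded function. -/
theorem inner_convOp_symm {W : L2 d L} (hW : (fun x => W (-x)) =ᵐ[volume] W) (u v : L2 d L) :
    ⟪toL2 (convOp W u), v⟫_ℝ = ⟪u, toL2 (convOp W v)⟫_ℝ := by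
  have hι : Continuous (toL2 : C(Torus d L, ℝ) → L2 d L) :=
    (ContinuousMap.toLp (E := ℝ) 2 (volume : Measure (Torus d L)) ℝ).continuous
  have hT := (convOp W).continuous
  have hd : DenseRange (toL2 : C(Torus d L, ℝ) → L2 d L) :=
    ContinuousMap.toLp_denseRange ℝ volume ℝ (by norm_num)
  refine hd.induction_on v (isClosed_eq (by fun_prop)
    (continuous_const.inner (hι.comp hT))) fun f => ?_
  rw [inner_toL2, inner_toL2]
  have h1 : ∫ x, toL2 (convOp W u) x * f x = ∫ x, ∫ y, u y * W (x - y) * f x := by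
    refine integral_congr_ae ?_
    filter_upwards [coeFn_toL2 (convOp W u)] with x hx
    rw [hx, convOp_apply, conv, ← integral_mul_const]
    simp only [mul_comm (W _)]
  have h2 : ∫ y, u y * convOp W (toL2 f) y = ∫ y, ∫ x, u y * W (x - y) * f x := by
    refine integral_congr_ae (Eventually.of_forall fun y => ?_)
    simp only
    rw [convOp, kernelOp_apply, inner_toL2, ← integral_const_mul]
    refine integral_congr_ae ?_
    filter_upwards [coeFn_convKernel W y,
      (measurePreserving_sub_left_torus y).quasiMeasurePreserving.ae hW] with x hx hx'
    rw [hx, ← hx', neg_sub, mul_assoc]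
  rw [h1, h2]
  refine integral_integral_swap ?_
  have h3 := (integrable_L2 u).convolution_integrand (ContinuousLinearMap.mul ℝ ℝ) (integrable_L2 W)
  exact h3.mul_bdd (f.continuous.comp continuous_fst).aestronglyMeasurable
    (Eventually.of_forall fun p => f.norm_coe_le_norm p.1)

theorem isCompactOperator_convOp (W : L2 d L) :
    IsCompactOperator (ContinuousMap.toLp (E := ℝ) 2 (volume : Measure (Torus d L)) ℝ ∘L convOp W) :=
  (isCompactOperator_kernelOp (convKernel W)).clm_comp
    (ContinuousMap.toLp (E := ℝ) 2 (volume : Measure (Torus d L)) ℝ)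

end Convolution

/-! ### Reflections and permutations of the coordinates -/

section Symmetries

/-- The reflection of the coordinates in `s`. -/
def reflHom (L : ℝ) (s : Finset (Fin d)) : Torus d L →ₜ+ Torus d L where
  toFun x i := if i ∈ s then -x i else x i
  map_zero' := by ext i; simp
  map_add' x y := by
    ext i
    by_cases h : i ∈ s
    · simp [h, add_comm]
    · simp [h]
  continuous_toFun := by
    refine continuous_pi fun i => ?_
    by_cases h : i ∈ s
    · simp only [h, if_true]
      exact (continuous_apply i).neg
    · simpa [h] using continuous_apply i

omit [Fact (0 < L)] in
theorem reflHom_apply (s : Finset (Fin d)) (x : Torus d L) (i : Fin d) :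
    reflHom L s x i = if i ∈ s then -x i else x i := rfl

omit [Fact (0 < L)] in
theorem reflHom_surjective (s : Finset (Fin d)) : Function.Surjective (reflHom L s) :=
  Function.Involutive.surjective fun x => by
    ext i
    by_cases h : i ∈ s <;> simp [reflHom_apply, h]

omit [Fact (0 < L)] in
theorem reflHom_singleton (i : Fin d) (x : Torus d L) :
    reflHom L {i} x = Function.update x i (-x i) := by
  ext j
  by_cases h : j = i
  · subst h; simp [reflHom_apply]
  · simp [reflHom_apply, h]

/-- The permutation of the coordinates by `ζ`. -/
def permHom (L : ℝ) (ζ : Equiv.Perm (Fin d)) : Torus d L →ₜ+ Torus d L where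
  toFun x i := x (ζ i)
  map_zero' := rfl
  map_add' _ _ := rfl
  continuous_toFun := by fun_prop

omit [Fact (0 < L)] in
theorem permHom_apply (ζ : Equiv.Perm (Fin d)) (x : Torus d L) (i : Fin d) :
    permHom L ζ x i = x (ζ i) := rfl

omit [Fact (0 < L)] in
theorem permHom_surjective (ζ : Equiv.Perm (Fin d)) : Function.Surjective (permHom L ζ) :=
  fun x => ⟨fun i => x (ζ.symm i), by ext i; simp [permHom_apply]⟩

theorem isCoordEven_iff (u : L2 d L) :
    IsCoordEven u ↔ ∀ i, pullback (reflHom L {i}) (reflHom_surjective _) u = u := by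
  refine forall_congr' fun i => ?_
  rw [pullback_eq_iff]
  have : u ∘ reflHom L {i} = fun x : Torus d L => u (Function.update x i (-x i)) := by
    funext x
    rw [Function.comp, reflHom_singleton]
  rw [this]

theorem isPermInvariant_iff (u : L2 d L) :
    IsPermInvariant u ↔ ∀ ζ, pullback (permHom L ζ) (permHom_surjective _) u = u := by
  refine forall_congr' fun ζ => ?_
  rw [pullback_eq_iff]
  rfl

/-- Negation is the composition of all coordinate reflections, added one at a time. -/
theorem IsCoordEven.neg {u : L2 d L} (hu : IsCoordEven u) : (fun x => u (-x)) =ᵐ[volume] u := by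
  rw [isCoordEven_iff] at hu
  have key : ∀ s : Finset (Fin d), u ∘ reflHom L s =ᵐ[volume] u := by
    intro s
    induction s using Finset.induction_on with
    | empty =>
      have : u ∘ reflHom L ∅ = u := by
        funext x
        rw [Function.comp]
        congr 1
      rw [this]
    | insert j s hj ih =>
      have h1 := (pullback_eq_iff _ _ u).1 (hu j)
      have h2 := (measurePreserving_automorphism (reflHom L s)
        (reflHom_surjective s)).quasiMeasurePreserving.ae h1
      filter_upwards [h2, ih] with x h2 h3
      have h4 : reflHom L (insert j s) x = reflHom L {j} (reflHom L s x) := by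
        ext i
        by_cases h : i = j
        · subst h; simp [reflHom_apply, hj]
        · simp [reflHom_apply, h]
      rw [Function.comp, h4]
      rw [Function.comp] at h2 h3
      rw [h2, h3]
  have h := key Finset.univ
  have h1 : u ∘ reflHom L Finset.univ = fun x => u (-x) := by
    funext x
    rw [Function.comp]
    congr 1
    ext i
    simp [reflHom_apply]
  rwa [h1] at h

end Symmetries

/-! ### Cosine modes: eigenfunctions and completeness -/

section Fourier

variable {𝕜 : Type*} [RCLike 𝕜]

theorem integrable_smul_continuousMap (u : L2 d L) (F : C(Torus d L, 𝕜)) :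
    Integrable fun x => u x • F x := by
  simp_rw [RCLike.real_smul_eq_coe_mul]
  exact (integrable_L2 u).ofReal.mul_bdd F.continuous.aestronglyMeasurable
    (Eventually.of_forall F.norm_coe_le_norm)

theorem integral_smul_comp (S : Torus d L →ₜ+ Torus d L) (hS : Function.Surjective S) {u : L2 d L}
    (hu : pullback S hS u = u) (F : C(Torus d L, 𝕜)) :
    ∫ x, u x • F (S x) = ∫ x, u x • F x := by
  have hmp := measurePreserving_automorphism S hS
  have key : ∀ G : Torus d L → 𝕜, AEStronglyMeasurable G volume → ∫ x, G (S x) = ∫ x, G x :=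
    fun G hG => by
      rw [← integral_map hmp.measurable.aemeasurable (by rwa [hmp.map_eq]), hmp.map_eq]
  rw [← key _ (integrable_smul_continuousMap u F).aestronglyMeasurable]
  refine integral_congr_ae ?_
  filter_upwards [(pullback_eq_iff S hS u).1 hu] with x hx
  rw [← hx, Function.comp]

/-- The product function `x ↦ ∏ i, f i (x i)` on the torus. -/
def prodMap (f : Fin d → C(AddCircle L, 𝕜)) : C(Torus d L, 𝕜) :=
  ⟨fun x => ∏ i, f i (x i), by fun_prop⟩

omit [Fact (0 < L)] in
theorem prodMap_apply (f : Fin d → C(AddCircle L, 𝕜)) (x : Torus d L) :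
    prodMap f x = ∏ i, f i (x i) := rfl

/-- The even part of a function on the circle. -/
def evenPart (f : C(AddCircle L, 𝕜)) : C(AddCircle L, 𝕜) :=
  ⟨fun x => (f x + f (-x)) / 2, by fun_prop⟩

omit [Fact (0 < L)] in
theorem evenPart_apply (f : C(AddCircle L, 𝕜)) (x : AddCircle L) :
    evenPart f x = (f x + f (-x)) / 2 := rfl

/-- Averaging the integrand over the reflection of one coordinate preserves the integral and
replaces that factor by its even part; the coordinates are treated one after another. -/
theorem integral_prodMap_evenPart {u : L2 d L} (hu : IsCoordEven u)
    (f : Fin d → C(AddCircle L, 𝕜)) :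
    ∫ x, u x • prodMap f x = ∫ x, u x • prodMap (fun i => evenPart (f i)) x := by
  rw [isCoordEven_iff] at hu
  have key : ∀ s : Finset (Fin d), ∫ x, u x • prodMap f x =
      ∫ x, u x • prodMap (fun i => if i ∈ s then evenPart (f i) else f i) x := by
    intro s
    induction s using Finset.induction_on with
    | empty => simp
    | insert j s hj ih =>
      rw [ih]
      set g : Fin d → C(AddCircle L, 𝕜) := fun i => if i ∈ s then evenPart (f i) else f i with hg
      set F := prodMap g
      have h1 : ∀ x : Torus d L,
          prodMap (fun i => if i ∈ insert j s then evenPart (f i) else f i) x =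
            (2 : 𝕜)⁻¹ * (F x + F (reflHom L {j} x)) := by
        intro x
        rw [prodMap_apply, prodMap_apply, prodMap_apply, ← Finset.mul_prod_erase _ _ (Finset.mem_univ j),
          ← Finset.mul_prod_erase _ (fun i => g i (x i)) (Finset.mem_univ j),
          ← Finset.mul_prod_erase _ (fun i => g i (reflHom L {j} x i)) (Finset.mem_univ j)]
        have h2 : ∏ i ∈ Finset.univ.erase j, g i (reflHom L {j} x i) =
            ∏ i ∈ Finset.univ.erase j, g i (x i) :=
          Finset.prod_congr rfl fun i hi => by
            simp [reflHom_apply, Finset.ne_of_mem_erase hi]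
        have h3 : ∏ i ∈ Finset.univ.erase j,
            (if i ∈ insert j s then evenPart (f i) else f i) (x i) =
            ∏ i ∈ Finset.univ.erase j, g i (x i) :=
          Finset.prod_congr rfl fun i hi => by
            simp [hg, Finset.mem_insert, Finset.ne_of_mem_erase hi]
        rw [h2, h3, ← add_mul, ← mul_assoc]
        congr 1
        simp only [Finset.mem_insert_self, if_true, evenPart_apply, hg, hj,
          if_false, reflHom_apply, Finset.mem_singleton]
        ring
      have hS := integral_smul_comp (reflHom L {j}) (reflHom_surjective _) (hu j) F
      have hi1 := integrable_smul_continuousMap u F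
      have hi2 : Integrable fun x => u x • F (reflHom L {j} x) :=
        integrable_smul_continuousMap u (F.comp (reflHom L {j} : C(Torus d L, Torus d L)))
      have h4 : ∀ x, u x • prodMap (fun i => if i ∈ insert j s then evenPart (f i) else f i) x =
          (2 : 𝕜)⁻¹ * (u x • F x + u x • F (reflHom L {j} x)) := fun x => by
        rw [h1, ← smul_add, mul_smul_comm]
      simp_rw [h4]
      rw [integral_const_mul, integral_add hi1 hi2, hS, ← two_mul, inv_mul_cancel_left₀ two_ne_zero]
  simpa using key Finset.univ

omit [Fact (0 < L)] in
-- The product-to-sum formula: the even part in `y` of `cos n(x - y)` is `cos nx cos ny`, which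
-- makes the modes eigenfunctions of convolution.
theorem fourier_re_add_mul (n : ℤ) (x y : AddCircle L) :
    ((fourier n (x - y)).re + (fourier n (x + y)).re) / 2 = (fourier n x).re * (fourier n y).re := by
  have h1 : (fourier n (x + y) : ℂ) = fourier n x * fourier n y := by
    simp [fourier_apply, smul_add, AddCircle.toCircle_add]
  have h2 : (fourier n (x - y) : ℂ) = fourier n x * (starRingEnd ℂ) (fourier n y) := by
    rw [← fourier_neg]
    simp [fourier_apply, sub_eq_add_neg, AddCircle.toCircle_add]
  rw [h1, h2, Complex.mul_re, Complex.mul_re, Complex.conj_re, Complex.conj_im]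
  ring

omit [Fact (0 < L)] in
theorem cosMode_neg (n : ℕ) (x : AddCircle L) : cosMode n (-x) = cosMode n x := by
  have : (fourier (n : ℤ) (-x) : ℂ) = (starRingEnd ℂ) (fourier (n : ℤ) x) := by
    rw [← fourier_neg]
    simp [fourier_apply]
  rw [cosMode, this, Complex.conj_re, cosMode]

omit [Fact (0 < L)] in
theorem cosMode_natAbs (n : ℤ) (x : AddCircle L) : cosMode n.natAbs x = (fourier n x).re := by
  rw [cosMode]
  rcases Int.natAbs_eq n with h | h
  · rw [← h]
  · conv_rhs => rw [h, fourier_neg, Complex.conj_re]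

/-- The one-dimensional mode as a continuous function. -/
def cosMap (L : ℝ) (n : ℕ) : C(AddCircle L, ℝ) := ⟨cosMode n, by unfold cosMode; fun_prop⟩

theorem Theta_pos (k : Fin d → ℕ) : 0 < Theta k :=
  Finset.prod_pos fun i _ => Real.sqrt_pos.2 (by split_ifs <;> norm_num)

theorem omega_eq (k : Fin d → ℕ) (x : Torus d L) :
    omega L k x = Theta k / L ^ ((d : ℝ) / 2) * prodMap (fun i => cosMap L (k i)) x := rfl

theorem L_pos : 0 < L := Fact.out

/-- The modes are eigenfunctions of the convolution with an even function. -/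
theorem convOp_omega {W : L2 d L} (hW : IsCoordEven W) (k : Fin d → ℕ) :
    convOp W (toL2 (omega L k)) = (fourierMode W k * L ^ ((d : ℝ) / 2) / Theta k) • omega L k := by
  ext x
  rw [convOp_toL2, ContinuousMap.smul_apply, smul_eq_mul, fourierMode]
  have hL : 0 < L ^ ((d : ℝ) / 2) := Real.rpow_pos_of_pos L_pos _
  have hΘ := Theta_pos k
  let f : Fin d → C(AddCircle L, ℝ) := fun i => ⟨fun y => cosMode (k i) (x i - y), by
    unfold cosMode; fun_prop⟩
  have h1 : ∀ y, W y * omega L k (x - y) = Theta k / L ^ ((d : ℝ) / 2) * (W y • prodMap f y) :=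
    fun y => by
      rw [omega_eq, smul_eq_mul]
      change W y * (_ * ∏ i, cosMode (k i) (x i - y i)) = _ * (W y * ∏ i, cosMode (k i) (x i - y i))
      ring
  have h2 : ∀ y, prodMap (fun i => evenPart (f i)) y = (∏ i, cosMode (k i) (x i)) *
      prodMap (fun i => cosMap L (k i)) y := fun y => by
    rw [prodMap_apply, prodMap_apply, ← Finset.prod_mul_distrib]
    refine Finset.prod_congr rfl fun i _ => ?_
    simp only [evenPart_apply, f, ContinuousMap.coe_mk, sub_neg_eq_add]
    exact fourier_re_add_mul _ _ _
  have h3 : ∀ y, W y * omega L k y = Theta k / L ^ ((d : ℝ) / 2) *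
      (W y * prodMap (fun i => cosMap L (k i)) y) := fun y => by
    rw [omega_eq]; ring
  simp_rw [h1, h3]
  rw [integral_const_mul, integral_const_mul, integral_prodMap_evenPart hW]
  simp_rw [h2, smul_eq_mul, mul_left_comm (W _)]
  rw [integral_const_mul]
  change _ = _ * (_ * ∏ i, cosMode (k i) (x i))
  field_simp

/-- The exponential modes on the torus. -/
def torusChar (L : ℝ) (n : Fin d → ℤ) : C(Torus d L, ℂ) := prodMap fun i => fourier (n i)

/-- Stone–Weierstrass. The characters are closed under products, so the algebra they generate is
their linear span, and the coordinate characters separate points. -/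
theorem span_torusChar_closure_eq_top :
    (Submodule.span ℂ (range (torusChar (d := d) L))).topologicalClosure = ⊤ := by
  let A : StarSubalgebra ℂ C(Torus d L, ℂ) :=
    { toSubalgebra := Algebra.adjoin ℂ (range (torusChar L))
      star_mem' := by
        change Algebra.adjoin ℂ (range (torusChar L)) ≤ star (Algebra.adjoin ℂ (range (torusChar L)))
        refine Algebra.adjoin_le ?_
        rintro _ ⟨n, rfl⟩
        refine Algebra.subset_adjoin ⟨-n, ?_⟩
        ext x
        simp [torusChar, prodMap] }
  have hspan : A.toSubalgebra.toSubmodule = Submodule.span ℂ (range (torusChar L)) := by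
    apply Algebra.adjoin_eq_span_of_subset
    refine .trans (fun x => Submonoid.closure_induction (fun _ => id) ⟨0, ?_⟩ ?_)
      Submodule.subset_span
    · ext z
      simp [torusChar, prodMap]
    · rintro _ _ _ _ ⟨m, rfl⟩ ⟨n, rfl⟩
      refine ⟨m + n, ?_⟩
      ext z
      simp [torusChar, prodMap, Finset.prod_mul_distrib]
  have hsep : A.SeparatesPoints := by
    intro x y hxy
    obtain ⟨i, hi⟩ := Function.ne_iff.1 hxy
    have h1 : ∀ z : Torus d L, torusChar L (Pi.single i 1) z = fourier 1 (z i) := fun z => by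
      change ∏ j, (fourier ((Pi.single i 1 : Fin d → ℤ) j) (z j) : ℂ) = _
      rw [Finset.prod_eq_single i (fun j _ hj => by simp [hj]) (by simp)]
      simp
    refine ⟨_, ⟨torusChar L (Pi.single i 1), Algebra.subset_adjoin ⟨_, rfl⟩, rfl⟩, ?_⟩
    dsimp only
    rw [h1, h1, fourier_one, fourier_one]
    exact fun h => hi (AddCircle.injective_toCircle L_pos.ne' (Circle.ext h))
  rw [← hspan]
  exact congrArg (fun B => Subalgebra.toSubmodule (StarSubalgebra.toSubalgebra B))
    (ContinuousMap.starSubalgebra_topologicalClosure_eq_top_of_separatesPoints A hsep)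

/-- Completeness of the cosine modes among the even functions. -/
theorem eq_zero_of_inner_omega {u : L2 d L} (hu : IsCoordEven u)
    (h : ∀ k, ⟪u, toL2 (omega L k)⟫_ℝ = 0) : u = 0 := by
  -- Against an even `u` an exponential may be replaced by its even part, the cosine product with
  -- frequencies `|n i|`.
  have h1 : ∀ n : Fin d → ℤ, ∫ x, u x • torusChar L n x = 0 := by
    intro n
    let k : Fin d → ℕ := fun i => (n i).natAbs
    have h2 : ∀ x, prodMap (fun i => evenPart (fourier (n i) : C(AddCircle L, ℂ))) x =
        ((prodMap (fun i => cosMap L (k i)) x : ℝ) : ℂ) := fun x => by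
      rw [prodMap_apply, prodMap_apply, Complex.ofReal_prod]
      refine Finset.prod_congr rfl fun i _ => ?_
      have h3 : (fourier (n i) (-x i) : ℂ) = (starRingEnd ℂ) (fourier (n i) (x i)) := by
        rw [← fourier_neg]
        simp [fourier_apply]
      rw [evenPart_apply, h3, Complex.add_conj, ← cosMode_natAbs]
      change _ = ((cosMode (n i).natAbs (x i) : ℝ) : ℂ)
      push_cast
      ring
    rw [torusChar, integral_prodMap_evenPart hu]
    simp_rw [h2]
    have h4 : ∀ x, u x • ((prodMap (fun i => cosMap L (k i)) x : ℝ) : ℂ) =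
        ((u x * prodMap (fun i => cosMap L (k i)) x : ℝ) : ℂ) := fun x => by
      rw [Complex.real_smul, Complex.ofReal_mul]
    simp_rw [h4]
    rw [integral_complex_ofReal]
    have h5 := h k
    rw [inner_toL2] at h5
    simp_rw [omega_eq, mul_left_comm (u _)] at h5
    rw [integral_const_mul] at h5
    have hL : 0 < L ^ ((d : ℝ) / 2) := Real.rpow_pos_of_pos L_pos _
    rcases mul_eq_zero.1 h5 with h6 | h6
    · exact absurd h6 (div_pos (Theta_pos k) hL).ne'
    · rw [h6, Complex.ofReal_zero]
  let Λ : C(Torus d L, ℂ) →L[ℂ] ℂ := LinearMap.mkContinuous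
    { toFun := fun F => ∫ x, u x • F x
      map_add' := fun F G => by
        simp_rw [ContinuousMap.add_apply, smul_add]
        exact integral_add (integrable_smul_continuousMap u F) (integrable_smul_continuousMap u G)
      map_smul' := fun c F => by
        simp_rw [ContinuousMap.smul_apply, smul_comm (u _) c]
        exact integral_smul c _ } (∫ x, ‖u x‖) fun F => by
    refine (norm_integral_le_integral_norm _).trans ?_
    rw [← integral_mul_const]
    refine integral_mono (integrable_smul_continuousMap u F).norm
      ((integrable_L2 u).norm.mul_const _) fun x => ?_
    simp only
    rw [norm_smul]
    exact mul_le_mul_of_nonneg_left (F.norm_coe_le_norm x) (norm_nonneg _)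
  have hΛ : ∀ F, Λ F = ∫ x, u x • F x := fun F => rfl
  have h2 : ∀ F, Λ F = 0 := fun F => by
    have h3 : (Submodule.span ℂ (range (torusChar (d := d) L))).topologicalClosure ≤
        LinearMap.ker (Λ : C(Torus d L, ℂ) →ₗ[ℂ] ℂ) := by
      refine Submodule.topologicalClosure_minimal _ (Submodule.span_le.2 ?_) Λ.isClosed_ker
      rintro _ ⟨n, rfl⟩
      exact h1 n
    rw [span_torusChar_closure_eq_top] at h3
    exact h3 trivial
  have h3 : ∀ f : C(Torus d L, ℝ), ⟪u, toL2 f⟫_ℝ = 0 := fun f => by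
    rw [inner_toL2]
    have h4 := h2 ⟨fun x => (f x : ℂ), by fun_prop⟩
    rw [hΛ] at h4
    have h5 : ∀ x, u x • ((f x : ℝ) : ℂ) = ((u x * f x : ℝ) : ℂ) := fun x => by
      rw [Complex.real_smul, Complex.ofReal_mul]
    simp only [ContinuousMap.coe_mk] at h4
    simp_rw [h5] at h4
    rw [integral_complex_ofReal] at h4
    exact_mod_cast h4
  have hd : DenseRange (toL2 : C(Torus d L, ℝ) → L2 d L) :=
    ContinuousMap.toLp_denseRange ℝ volume ℝ (by norm_num)
  have h4 : ∀ v, ⟪u, v⟫_ℝ = 0 := fun v =>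
    hd.induction_on v (isClosed_eq (by fun_prop) continuous_const) h3
  exact inner_self_eq_zero.1 (h4 u)

end Fourier

/-! ### Symmetries of the modes -/

section ModeSymmetries

theorem omega_reflHom (k : Fin d → ℕ) (i : Fin d) (x : Torus d L) :
    omega L k (reflHom L {i} x) = omega L k x := by
  rw [omega_eq, omega_eq, prodMap_apply, prodMap_apply]
  congr 1
  refine Finset.prod_congr rfl fun j _ => ?_
  rw [reflHom_apply]
  split_ifs
  · exact cosMode_neg _ _
  · rfl

theorem omega_permHom (k : Fin d → ℕ) (ζ : Equiv.Perm (Fin d)) (x : Torus d L) :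
    omega L k (permHom L ζ x) = omega L (fun i => k (ζ.symm i)) x := by
  rw [omega_eq, omega_eq]
  have h1 : Theta (fun i => k (ζ.symm i)) = Theta k :=
    Equiv.prod_comp ζ.symm fun i => √(2 - if k i = 0 then 1 else 0)
  rw [h1]
  congr 1
  change ∏ i, cosMode (k i) (x (ζ i)) = ∏ i, cosMode (k (ζ.symm i)) (x i)
  rw [← Equiv.prod_comp ζ fun i => cosMode (k (ζ.symm i)) (x i)]
  simp only [Equiv.symm_apply_apply]

theorem mem_permClass (k l : Fin d → ℕ) :
    l ∈ permClass k ↔ ∃ ζ : Equiv.Perm (Fin d), (fun i => k (ζ i)) = l := by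
  simp [permClass]

theorem omegaSym_apply (k : Fin d → ℕ) (x : Torus d L) :
    omegaSym L k x = 1 / √((permClass k).card : ℝ) * ∑ l ∈ permClass k, omega L l x := by
  simp [omegaSym]

theorem omegaSym_reflHom (k : Fin d → ℕ) (i : Fin d) (x : Torus d L) :
    omegaSym L k (reflHom L {i} x) = omegaSym L k x := by
  simp_rw [omegaSym_apply, omega_reflHom]

theorem omegaSym_permHom (k : Fin d → ℕ) (ζ : Equiv.Perm (Fin d)) (x : Torus d L) :
    omegaSym L k (permHom L ζ x) = omegaSym L k x := by
  simp only [omegaSym_apply, omega_permHom]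
  congr 1
  refine Finset.sum_bij' (fun l _ => fun i => l (ζ.symm i)) (fun l _ => fun i => l (ζ i)) ?_ ?_ ?_ ?_ ?_
  · intro l hl
    obtain ⟨ξ, rfl⟩ := (mem_permClass k l).1 hl
    exact (mem_permClass k _).2 ⟨ζ.symm.trans ξ, rfl⟩
  · intro l hl
    obtain ⟨ξ, rfl⟩ := (mem_permClass k l).1 hl
    exact (mem_permClass k _).2 ⟨ζ.trans ξ, rfl⟩
  · intro l _; simp
  · intro l _; simp
  · intro l _; rfl

/-- The coefficients of an exchangeable function are constant on permutation classes. -/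
theorem inner_omega_of_mem_permClass {u : L2 d L} (hu : IsPermInvariant u) {k l : Fin d → ℕ}
    (hl : l ∈ permClass k) : ⟪u, toL2 (omega L l)⟫_ℝ = ⟪u, toL2 (omega L k)⟫_ℝ := by
  obtain ⟨ζ, rfl⟩ := (mem_permClass k l).1 hl
  have h1 := integral_smul_comp (permHom L ζ.symm) (permHom_surjective _)
    ((isPermInvariant_iff u).1 hu ζ.symm) (omega L k)
  rw [inner_toL2, inner_toL2]
  simp_rw [omega_permHom, Equiv.symm_symm, smul_eq_mul] at h1
  exact h1

end ModeSymmetries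

/-! ### The homogeneous branch -/

section HomogeneousBranch

theorem StandingAssumption.monotone {Φ : ℝ → ℝ} {W : L2 d L} {B : ℝ}
    (hA : StandingAssumption Φ W B) : Monotone Φ := by
  have hnn : ∀ s, 0 ≤ s → 0 ≤ Φ s := fun s hs => by
    rw [← hA.eq_zero 0 le_rfl]
    exact hA.monotoneOn self_mem_Ici hs hs
  intro s t hst
  rcases le_total s 0 with hs | hs
  · rw [hA.eq_zero s hs]
    rcases le_total t 0 with ht | ht
    · rw [hA.eq_zero t ht]
    · exact hnn t ht
  · exact hA.monotoneOn hs (hs.trans hst) hst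

theorem StandingAssumption.nonneg {Φ : ℝ → ℝ} {W : L2 d L} {B : ℝ}
    (hA : StandingAssumption Φ W B) (s : ℝ) : 0 ≤ Φ s := by
  rcases le_total s 0 with hs | hs
  · rw [hA.eq_zero s hs]
  · rw [← hA.eq_zero 0 le_rfl]
    exact hA.monotone hs

theorem constL2_eq_toL2 (c : ℝ) : constL2 d L c = toL2 (ContinuousMap.const _ c) := by
  rw [Lp.ext_iff]
  filter_upwards [coeFn_toL2 (ContinuousMap.const (Torus d L) c),
    Lp.coeFn_const (p := 2) (μ := (volume : Measure (Torus d L))) c] with x h1 h2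
  rw [h1, constL2, h2]
  rfl

theorem coeFn_constL2 (c : ℝ) : constL2 d L c =ᵐ[volume] fun _ => c :=
  Lp.coeFn_const (p := 2) (μ := (volume : Measure (Torus d L))) c

theorem convOp_constL2 (W : L2 d L) (c : ℝ) (x : Torus d L) :
    convOp W (constL2 d L c) x = totalIntegral W * c := by
  rw [constL2_eq_toL2, convOp_toL2]
  simp only [ContinuousMap.const_apply]
  rw [integral_mul_const, totalIntegral]

variable {Φ : ℝ → ℝ} {W : L2 d L} {B : ℝ}

theorem isStationaryMean_iff (u : L2 d L) {κ : ℝ} (hκ : 0 < κ) :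
    IsStationaryMean Φ W B u κ ↔
      u =ᵐ[volume] fun x => response Φ (L ^ d) (convOp W u x + B) κ := by
  have h : ∀ x, meanFunctional Φ W B u κ x = u x - response Φ (L ^ d) (convOp W u x + B) κ :=
    fun x => by
      rw [meanFunctional, convOp_apply, response, ← integral_ratio_eq_truncMean κ _ hκ]
      congr 1
      rw [mul_comm (L ^ d), ← div_div, div_mul_eq_mul_div, div_mul_eq_mul_div, one_mul]
  refine eventually_congr (Eventually.of_forall fun x => ?_)
  rw [h, Pi.zero_apply, sub_eq_zero]

theorem isStationaryMean_constL2_iff (c : ℝ) {κ : ℝ} (hκ : 0 < κ) :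
    IsStationaryMean Φ W B (constL2 d L c) κ ↔
      c = response Φ (L ^ d) (totalIntegral W * c + B) κ := by
  rw [isStationaryMean_iff _ hκ]
  simp_rw [convOp_constL2]
  constructor
  · intro h
    obtain ⟨x, h1, h2⟩ := (h.and (coeFn_constL2 c)).exists
    rwa [h2] at h1
  · intro h
    filter_upwards [coeFn_constL2 (d := d) (L := L) c] with x hx
    rw [hx]
    exact h

theorem existsUnique_isStationaryMean_constL2 (hA : StandingAssumption Φ W B) {κ : ℝ}
    (hκ : 0 < κ) : ∃! r : ℝ, IsStationaryMean Φ W B (constL2 d L r) κ := by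
  simp_rw [isStationaryMean_constL2_iff _ hκ]
  exact existsUnique_response_fixedPoint hA.continuous hA.monotone hA.nonneg
    (pow_pos L_pos d) hκ hA.integral_neg B

/-- Existence gives the `epsilon` choice its defining property, and uniqueness makes it
characteristic. -/
theorem eq_response_iff_eq_rhoInf (hA : StandingAssumption Φ W B) (κ : ℝ) (hκ : 0 < κ) (x : ℝ) :
    x = response Φ (L ^ d) (totalIntegral W * x + B) κ ↔ x = rhoInf Φ W B κ := by
  obtain ⟨r, hr, hu⟩ := existsUnique_isStationaryMean_constL2 hA hκ
  have h1 : IsStationaryMean Φ W B (constL2 d L (rhoInf Φ W B κ)) κ :=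
    Classical.epsilon_spec (p := fun r : ℝ => IsStationaryMean Φ W B (constL2 d L r) κ) ⟨r, hr⟩
  rw [← isStationaryMean_constL2_iff x hκ]
  refine ⟨fun h => (hu _ h).trans (hu _ h1).symm, fun h => ?_⟩
  rw [h]
  exact h1

end HomogeneousBranch

/-! ### The bifurcating branch in a symmetric subspace -/

section Branch

variable {Φ : ℝ → ℝ} {W : L2 d L} {B : ℝ}

theorem toL2_eq_toLp (f : C(Torus d L, ℝ)) :
    ContinuousMap.toLp (E := ℝ) 2 (volume : Measure (Torus d L)) ℝ f = toL2 f := rfl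

/-- Near the homogeneous branch the stationarity equation is an equation for the perturbation. -/
theorem eventually_isStationaryMean_iff (hA : StandingAssumption Φ W B) {κ : ℝ} (hκ : 0 < κ)
    (g : C(ℝ × ℝ, ℝ))
    (hg : ∀ᶠ q in 𝓝 ((0 : ℝ), κ), g q * q.1 =
      response Φ (L ^ d) (totalIntegral W * rhoInf Φ W B q.2 + B + q.1) q.2 -
        response Φ (L ^ d) (totalIntegral W * rhoInf Φ W B q.2 + B) q.2) :
    ∀ᶠ p in 𝓝 ((0 : L2 d L), κ),
      IsStationaryMean Φ W B (constL2 d L (rhoInf Φ W B p.2) + p.1) p.2 ↔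
        p.1 = toL2 (superpos g (convOp W p.1, p.2) * convOp W p.1) := by
  obtain ⟨ε, hε, hball⟩ := Metric.eventually_nhds_iff.1 hg
  have h1 : ∀ᶠ p in 𝓝 ((0 : L2 d L), κ), dist (convOp W p.1, p.2) (0, κ) < ε := by
    have : Continuous fun p : L2 d L × ℝ => dist (convOp W p.1, p.2) (0, κ) := by fun_prop
    exact (this.tendsto _).eventually_lt_const (by simpa using hε)
  have h2 : ∀ᶠ p in 𝓝 ((0 : L2 d L), κ), 0 < p.2 :=
    (continuous_snd.tendsto ((0 : L2 d L), κ)).eventually (lt_mem_nhds hκ)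
  filter_upwards [h1, h2] with p h1 h2
  obtain ⟨v, κ'⟩ := p
  simp only at h1 h2 ⊢
  set r := rhoInf Φ W B κ' with hr
  -- Smallness of `v` in `L²` makes `W * v` uniformly small, so the local slope identity holds at
  -- every `x`.
  have h3 : ∀ x, g (convOp W v x, κ') * convOp W v x =
      response Φ (L ^ d) (convOp W (constL2 d L r + v) x + B) κ' - r := fun x => by
    have h4 : dist (convOp W v x, κ') ((0 : ℝ), κ) < ε := by
      refine lt_of_le_of_lt ?_ h1
      rw [Prod.dist_eq, Prod.dist_eq]
      refine max_le_max ?_ le_rfl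
      simpa using (convOp W v).norm_coe_le_norm x
    have h5 := hball h4
    simp only at h5
    rw [← hr, ← (eq_response_iff_eq_rhoInf hA κ' h2 r).2 hr] at h5
    rw [h5, map_add, ContinuousMap.add_apply, convOp_constL2]
    congr 2
    ring
  rw [isStationaryMean_iff _ h2, Lp.ext_iff]
  have h4 := coeFn_toL2 (superpos g (convOp W v, κ') * convOp W v)
  constructor
  · intro h
    filter_upwards [h, h4, Lp.coeFn_add (constL2 d L r) v, coeFn_constL2 (d := d) (L := L) r]
      with x e1 e2 e3 e4
    rw [e2, ContinuousMap.mul_apply, superpos_apply, h3, ← e1, e3, Pi.add_apply, e4,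
      add_sub_cancel_left]
  · intro h
    filter_upwards [h, h4, Lp.coeFn_add (constL2 d L r) v, coeFn_constL2 (d := d) (L := L) r]
      with x e1 e2 e3 e4
    rw [e3, Pi.add_apply, e4, e1, e2, ContinuousMap.mul_apply, superpos_apply, h3, add_sub_cancel]

theorem constL2_mem_invariants {I : Type*} {S : I → (Torus d L →ₜ+ Torus d L)}
    {hS : ∀ i, Function.Surjective (S i)} (c : ℝ) : constL2 d L c ∈ invariants S hS := by
  rw [constL2_eq_toL2]
  exact fun i => pullback_toL2 _ _ _ fun x => rfl

theorem responseDeriv_nonneg (hA : StandingAssumption Φ W B) (s κ : ℝ) :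
    0 ≤ responseDeriv Φ (L ^ d) s κ :=
  div_nonneg (mul_nonneg (truncVar_pos (mul_nonneg (Real.sqrt_nonneg _) (hA.nonneg _))).le
    hA.monotone.deriv_nonneg) (pow_pos L_pos d).le

/-- A mode in the kernel of the linearisation is orthogonal to the constants. -/
theorem inner_constL2_eq_zero (hW : IsCoordEven W) (hA : StandingAssumption Φ W B) {c : ℝ}
    (hc : 0 ≤ c) {ω : C(Torus d L, ℝ)} (hω : c • convOp W (toL2 ω) = ω) (a : ℝ) :
    ⟪toL2 ω, constL2 d L a⟫_ℝ = 0 := by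
  have h1 : toL2 (convOp W (constL2 d L a)) = totalIntegral W • constL2 d L a := by
    rw [constL2_eq_toL2, ← toL2_eq_toLp, ← toL2_eq_toLp, ← map_smul]
    congr 1
    ext x
    rw [toL2_eq_toLp, ← constL2_eq_toL2, convOp_constL2]
    rfl
  have h2 : toL2 ω = c • toL2 (convOp W (toL2 ω)) := by
    conv_lhs => rw [← hω]
    exact map_smul (ContinuousMap.toLp (E := ℝ) 2 (volume : Measure (Torus d L)) ℝ) c _
  -- Constants are eigenvectors of `c W *` with eigenvalue `c W₀ ≤ 0`, whereas `ω` has eigenvalue 1,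
  -- and the operator is symmetric.
  have h3 : ⟪toL2 ω, constL2 d L a⟫_ℝ = c * totalIntegral W * ⟪toL2 ω, constL2 d L a⟫_ℝ := by
    conv_lhs => rw [h2]
    rw [real_inner_smul_left, inner_convOp_symm hW.neg, h1, inner_smul_right]
    ring
  have h4 : c * totalIntegral W ≤ 0 := mul_nonpos_of_nonneg_of_nonpos hc hA.integral_neg.le
  have h5 : (1 - c * totalIntegral W) * ⟪toL2 ω, constL2 d L a⟫_ℝ = 0 := by linarith
  rcases mul_eq_zero.1 h5 with h | h
  · linarith
  · exact h

/-- Bifurcation in a space of symmetric functions in which the kernel of the linearisation is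
spanned by `ω`. -/
theorem hasBranch_invariants (hW : IsCoordEven W) (hA : StandingAssumption Φ W B) {κ : ℝ}
    (hκ : 0 < κ) (hΦ : ContDiffAt ℝ 2 Φ (homInput Φ W B κ))
    (hΦ' : deriv Φ (homInput Φ W B κ) ≠ 0) (hΦ'' : 0 ≤ deriv (deriv Φ) (homInput Φ W B κ))
    {I : Type*} (S : I → (Torus d L →ₜ+ Torus d L)) (hS : ∀ i, Function.Surjective (S i))
    (hWS : W ∈ invariants S hS) (ω : C(Torus d L, ℝ)) (hωV : toL2 ω ∈ invariants S hS)
    (hω : responseDeriv Φ (L ^ d) (homInput Φ W B κ) κ • convOp W (toL2 ω) = ω)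
    (hne : toL2 ω ≠ 0)
    (hker : ∀ v ∈ invariants S hS,
      responseDeriv Φ (L ^ d) (homInput Φ W B κ) κ • toL2 (convOp W v) = v →
      ⟪toL2 ω, v⟫_ℝ = 0 → v = 0) :
    HasBranch Φ W B κ (invariants S hS) ω := by
  have hD : 0 < L ^ d := pow_pos L_pos d
  have hfix := eq_response_iff_eq_rhoInf hA
  obtain ⟨g, hg, hg0, ⟨a, ha, haD⟩, hslope⟩ := exists_response_slope hA.monotone hA.nonneg hD
    hA.integral_neg hfix hκ hΦ hΦ' hΦ''
  change g (0, κ) = responseDeriv Φ (L ^ d) (homInput Φ W B κ) κ at hg0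
  rw [← hg0] at hω hker
  have hinv : ∀ u ∈ invariants S hS, ∀ i x, convOp W u (S i x) = convOp W u x :=
    fun u hu i x => convOp_comp (S i) (hS i) (hWS i) (hu i) x
  obtain ⟨w, k, η, hw, hk, hw0, hk0, hwV, hη, hcurve, huniq⟩ :=
    exists_bifurcating_curve (invariants S hS) (convOp W)
      (ContinuousMap.toLp (E := ℝ) 2 (volume : Measure (Torus d L)) ℝ) g hg κ a
      (isCompactOperator_convOp W) (inner_convOp_symm hW.neg)
      (fun u hu i => pullback_toL2 _ _ _ (hinv u hu i))
      (fun u hu z κ' i => pullback_toL2 _ _ _ fun x => by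
        simp only [ContinuousMap.mul_apply, superpos_apply, ContinuousMap.smul_apply, hinv u hu i])
      ω hωV hω hne hker haD ha.ne'
  simp only [toL2_eq_toLp] at hcurve huniq
  have heq := eventually_isStationaryMean_iff hA hκ g hslope
  have hr : ContDiffAt ℝ 1 (rhoInf Φ W B) κ := contDiffAt_fixedPoint hA.monotone hA.nonneg hD
    hA.integral_neg hfix hκ (hΦ.of_le one_le_two)
  have hrk : ContDiffAt ℝ 1 (fun z => rhoInf Φ W B (k z)) 0 := by
    rw [← hk0] at hr
    exact ContDiffAt.comp (g := rhoInf Φ W B) (f := k) 0 hr hk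
  have hconst : ContDiff ℝ 1 (constL2 d L) :=
    (Lp.constL 2 (volume : Measure (Torus d L)) ℝ : ℝ →L[ℝ] L2 d L).contDiff
  let v : ℝ → L2 d L := fun z => z • (toL2 ω + w z)
  let ρ : ℝ → L2 d L := fun z => constL2 d L (rhoInf Φ W B (k z)) + v z
  have hv : ContDiffAt ℝ 1 v 0 := contDiffAt_id.smul (contDiffAt_const.add hw)
  have hρ : ContDiffAt ℝ 1 ρ 0 := (hconst.contDiffAt.comp 0 hrk).add hv
  have hvV : ∀ z, v z ∈ invariants S hS := fun z =>
    Submodule.smul_mem _ _ (Submodule.add_mem _ hωV (hwV z))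
  have hvk : Tendsto (fun z => (v z, k z)) (𝓝 0) (𝓝 (0, κ)) := by
    have h := hv.continuousAt.tendsto.prodMk_nhds hk.continuousAt.tendsto
    simpa [v, hk0] using h
  have hstat : ∀ᶠ z in 𝓝 (0 : ℝ), IsStationaryMean Φ W B (ρ z) (k z) := by
    filter_upwards [hvk.eventually heq, hcurve] with z h1 h2
    refine h1.2 ?_
    change z • (toL2 ω + w z) = _
    conv_lhs => rw [h2.2.2]
    simp only [v, map_smul]
    rw [mul_smul_comm]
    exact (map_smul (ContinuousMap.toLp (E := ℝ) 2 (volume : Measure (Torus d L)) ℝ) z _).symm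
  have hkpos : ∀ᶠ z in 𝓝 (0 : ℝ), 0 < k z :=
    hk.continuousAt.tendsto.eventually (by rw [hk0]; exact lt_mem_nhds hκ)
  obtain ⟨δ, hδ, hball⟩ := Metric.eventually_nhds_iff.1
    ((hρ.eventually (by simp)).and ((hk.eventually (by simp)).and
      (hstat.and (hkpos.and hcurve))))
  have hball' : ∀ z ∈ Ioo (-δ) δ, dist z 0 < δ := fun z hz => by
    rw [Real.dist_eq, sub_zero]; exact abs_lt.2 hz
  have hz0 : ∀ z, ρ z - constL2 d L (rhoInf Φ W B (k z)) = v z := fun z => add_sub_cancel_left _ _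
  refine ⟨δ, hδ, ρ, k, fun z hz => (hball (hball' z hz)).1.contDiffWithinAt,
    fun z hz => (hball (hball' z hz)).2.1.contDiffWithinAt, ?_, hk0, ?_, ?_, ?_, ?_, ?_⟩
  · simp [ρ, v, hk0]
  · intro z hz
    obtain ⟨-, -, h1, h2, -⟩ := hball (hball' z hz)
    exact ⟨Submodule.add_mem _ (constL2_mem_invariants _) (hvV z), h2, h1⟩
  · intro z hz hzne c hc
    obtain ⟨-, -, -, -, h1, -⟩ := hball (hball' z hz)
    have hcn : 0 ≤ g (0, κ) := by rw [hg0]; exact responseDeriv_nonneg hA _ _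
    have h2 := hz0 z
    rw [hc] at h2
    -- Both `w z` and the constants are orthogonal to `ω`, so a constant `ρ z` would force `z ‖ω‖² =
    -- 0`.
    have h3 := congrArg (fun u => ⟪toL2 ω, u⟫_ℝ) h2
    simp only [v, inner_sub_right, inner_smul_right, inner_add_right, h1,
      inner_constL2_eq_zero hW hA hcn hω, add_zero, sub_zero] at h3
    rcases mul_eq_zero.1 h3.symm with h | h
    · exact hzne h
    · exact hne (inner_self_eq_zero.1 h)
  · have h1 : ∀ z, ρ z - constL2 d L (rhoInf Φ W B (k z)) - z • toL2 ω = z • w z := fun z => by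
      rw [hz0, ← smul_sub, add_sub_cancel_left]
    simp_rw [h1]
    rw [isLittleO_iff]
    intro c hc
    have h2 : Tendsto w (𝓝 0) (𝓝 0) := by simpa [hw0] using hw.continuousAt.tendsto
    filter_upwards [Metric.tendsto_nhds.1 h2 c hc] with z hz
    rw [dist_zero_right] at hz
    rw [norm_smul, mul_comm]
    gcongr
  · intro e he
    filter_upwards [Metric.tendsto_nhds.1 hη e he, hcurve] with z h1 h2
    rw [dist_zero_right] at h1
    filter_upwards [Lp.coeFn_add (constL2 d L (rhoInf Φ W B (k z))) (v z),
      coeFn_constL2 (d := d) (L := L) (rhoInf Φ W B (k z)), Lp.coeFn_smul z (toL2 ω + w z),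
      Lp.coeFn_add (toL2 ω) (w z), coeFn_toL2 ω, coeFn_toL2 (η z)] with x e1 e2 e3 e4 e5 e6
    have e7 : w z x = η z x := by rw [h2.2.1, e6]
    have e8 : ρ z x = rhoInf Φ W B (k z) + z * (ω x + η z x) := by
      rw [e1, Pi.add_apply, e2, e3, Pi.smul_apply, e4, Pi.add_apply, e5, e7, smul_eq_mul]
    have e9 : ρ z x - (rhoInf Φ W B (k z) + z * ω x) = η z x * z := by rw [e8]; ring
    rw [e9, abs_mul]
    gcongr
    exact ((η z).norm_coe_le_norm x).trans h1.le
  · have hz : ∀ᶠ p in 𝓝 ((0 : L2 d L), κ), |⟪toL2 ω, p.1⟫_ℝ / ‖toL2 ω‖ ^ 2| < δ := by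
      have h1 : Continuous fun p : L2 d L × ℝ => |⟪toL2 ω, p.1⟫_ℝ / ‖toL2 ω‖ ^ 2| := by fun_prop
      exact (h1.tendsto _).eventually_lt_const (by simpa using hδ)
    have hshift : Tendsto (fun p : L2 d L × ℝ => (p.1 - constL2 d L (rhoInf Φ W B p.2), p.2))
        (𝓝 (constL2 d L (rhoInf Φ W B κ), κ)) (𝓝 (0, κ)) := by
      have h1 : ContinuousAt (fun p : L2 d L × ℝ => constL2 d L (rhoInf Φ W B p.2))
          (constL2 d L (rhoInf Φ W B κ), κ) :=
        hconst.continuous.continuousAt.comp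
          (ContinuousAt.comp (g := rhoInf Φ W B) (f := Prod.snd)
            (x := (constL2 d L (rhoInf Φ W B κ), κ)) hr.continuousAt continuousAt_snd)
      have h2 := ((continuousAt_fst.sub h1).prodMk continuousAt_snd).tendsto
      simpa using h2
    obtain ⟨U, hU, K, hK, hUK⟩ := mem_nhds_prod_iff.1
      (hshift.eventually (heq.and (huniq.and hz)))
    obtain ⟨ε, hε, hεK⟩ := Metric.mem_nhds_iff.1 hK
    refine ⟨U, hU, min ε κ, lt_min hε hκ, min_le_right _ _, ?_⟩
    rintro u ⟨huU, huV⟩ κ' ⟨h1, h2⟩ hu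
    have hκ' : κ' ∈ K := hεK (by
      rw [Metric.mem_ball, Real.dist_eq, abs_lt]
      constructor <;> linarith [min_le_left ε κ])
    obtain ⟨p1, p2, p3⟩ := hUK (mk_mem_prod huU hκ')
    simp only [add_sub_cancel] at p1 p2 p3
    rcases p2 (Submodule.sub_mem _ huV (constL2_mem_invariants _)) (p1.1 hu) with h | ⟨h3, h4⟩
    · exact Or.inl (sub_eq_zero.1 h)
    · refine Or.inr ⟨_, abs_lt.1 p3, ?_, h4⟩
      change u = constL2 d L (rhoInf Φ W B (k _)) + _ • _
      rw [← h4, ← h3, add_sub_cancel]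

theorem isBifurcationPoint_of_hasBranch {κ : ℝ}
    {V : Set (L2 d L)} (hV : V ⊆ L2S d L) {ω : C(Torus d L, ℝ)} (h : HasBranch Φ W B κ V ω) :
    IsBifurcationPoint Φ W B κ := by
  obtain ⟨δ, hδ, ρ, k, hρ, hk, hρ0, hk0, hsol, hne, -⟩ := h
  have h0 : (0 : ℝ) ∈ Ioo (-δ) δ := ⟨by linarith, hδ⟩
  have hnhds : Ioo (-δ) δ ∈ 𝓝 (0 : ℝ) := isOpen_Ioo.mem_nhds h0
  refine ⟨?_, ?_⟩
  · obtain ⟨h1, h2, h3⟩ := hsol 0 h0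
    rw [hρ0] at h1 h3
    rw [hk0] at h2 h3
    exact ⟨hV h1, h2, h3⟩
  · have hc : Tendsto (fun z => (ρ z, k z)) (𝓝[≠] 0) (𝓝 (constL2 d L (rhoInf Φ W B κ), κ)) := by
      have h1 := (hρ.continuousOn.continuousAt hnhds).tendsto.prodMk_nhds
        (hk.continuousOn.continuousAt hnhds).tendsto
      rw [hρ0, hk0] at h1
      exact h1.mono_left nhdsWithin_le_nhds
    refine mem_closure_of_tendsto hc ?_
    filter_upwards [nhdsWithin_le_nhds hnhds, self_mem_nhdsWithin] with z hz hz0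
    obtain ⟨h1, h2, h3⟩ := hsol z hz
    exact ⟨⟨hV h1, h2, h3⟩, fun h => hne z hz hz0 _ h.2⟩

end Branch

/-! ### The mode equation and the kernel of the linearisation -/

section Modes

variable {Φ : ℝ → ℝ} {W : L2 d L} {B : ℝ}

/-- Since `truncMean = Lᵈ ρ̄∞` on the homogeneous branch, `truncVar_eq` turns the bracket in the
mode equation into `truncVar / Lᵈ`, so the equation says that the linearised operator has eigenvalue
1 at `ω_l`. -/
theorem modeCondition_iff (hA : StandingAssumption Φ W B) {κ : ℝ} (hκ : 0 < κ)
    (hΦ' : deriv Φ (homInput Φ W B κ) ≠ 0) (l : Fin d → ℕ) :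
    ModeCondition Φ W B κ l ↔ responseDeriv Φ (L ^ d) (homInput Φ W B κ) κ *
      (fourierMode W l * L ^ ((d : ℝ) / 2) / Theta l) = 1 := by
  have hD : 0 < L ^ d := pow_pos L_pos d
  have hR : 0 < L ^ ((d : ℝ) / 2) := Real.rpow_pos_of_pos L_pos _
  have hΘ := Theta_pos l
  have hv : 0 < truncVar (√κ * Φ (homInput Φ W B κ)) :=
    truncVar_pos (mul_nonneg (Real.sqrt_nonneg _) (hA.nonneg _))
  have hρ : truncMean (Φ (homInput Φ W B κ)) κ = L ^ d * rhoInf Φ W B κ := by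
    have := (eq_response_iff_eq_rhoInf hA κ hκ _).2 rfl
    rw [response, eq_div_iff hD.ne'] at this
    rw [homInput, ← this, mul_comm]
  have hm : 1 / L ^ d - L ^ d * rhoInf Φ W B κ *
      (rhoInf Φ W B κ - Φ (homInput Φ W B κ) / L ^ d) * κ =
      truncVar (√κ * Φ (homInput Φ W B κ)) / L ^ d := by
    rw [truncVar_eq κ _ hκ, hρ]
    field_simp
  rw [ModeCondition, hm, responseDeriv]
  field_simp

/-- Eigenvectors of a symmetric operator with distinct eigenvalues are orthogonal. -/
theorem inner_omega_eq_zero (hW : IsCoordEven W) {c : ℝ} {v : L2 d L}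
    (hv : c • toL2 (convOp W v) = v) {l : Fin d → ℕ}
    (hl : c * (fourierMode W l * L ^ ((d : ℝ) / 2) / Theta l) ≠ 1) :
    ⟪v, toL2 (omega L l)⟫_ℝ = 0 := by
  set q := fourierMode W l * L ^ ((d : ℝ) / 2) / Theta l with hq
  have h1 : toL2 (convOp W (toL2 (omega L l))) = q • toL2 (omega L l) := by
    rw [convOp_omega hW, ← hq]
    exact map_smul (ContinuousMap.toLp (E := ℝ) 2 (volume : Measure (Torus d L)) ℝ) q _
  have h2 : ⟪v, toL2 (omega L l)⟫_ℝ = c * q * ⟪v, toL2 (omega L l)⟫_ℝ := by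
    conv_lhs => rw [← hv]
    rw [real_inner_smul_left, inner_convOp_symm hW.neg, h1, inner_smul_right]
    ring
  have h3 : (1 - c * q) * ⟪v, toL2 (omega L l)⟫_ℝ = 0 := by linarith
  exact (mul_eq_zero.1 h3).resolve_left (sub_ne_zero.2 (Ne.symm hl))

theorem toL2_ne_zero {f : C(Torus d L, ℝ)} (hf : 0 < f 0) : toL2 f ≠ 0 := by
  intro h
  have h1 : f = 0 := ContinuousMap.toLp_injective (E := ℝ) (p := 2)
    (volume : Measure (Torus d L)) (𝕜 := ℝ) (h.trans (map_zero _).symm)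
  rw [h1] at hf
  exact lt_irrefl _ hf

theorem omega_zero_pos (k : Fin d → ℕ) : 0 < omega L k 0 := by
  have h : prodMap (fun i => cosMap L (k i)) (0 : Torus d L) = 1 := by
    rw [prodMap_apply]
    refine Finset.prod_eq_one fun i _ => ?_
    change cosMode (k i) (0 : AddCircle L) = 1
    simp [cosMode]
  rw [omega_eq, h, mul_one]
  exact div_pos (Theta_pos k) (Real.rpow_pos_of_pos L_pos _)

theorem permClass_card_pos (k : Fin d → ℕ) : 0 < ((permClass k).card : ℝ) :=
  Nat.cast_pos.2 (Finset.card_pos.2 ⟨k, (mem_permClass k k).2 ⟨1, rfl⟩⟩)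

theorem omegaSym_zero_pos (k : Fin d → ℕ) : 0 < omegaSym L k 0 := by
  rw [omegaSym_apply]
  have h := permClass_card_pos k
  exact mul_pos (by positivity) (Finset.sum_pos (fun l _ => omega_zero_pos l)
    ⟨k, (mem_permClass k k).2 ⟨1, rfl⟩⟩)

theorem L2S_eq : L2S d L =
    SetLike.coe (invariants (fun i : Fin d => reflHom L {i})
      (fun _ => reflHom_surjective _)) := by
  ext u
  exact isCoordEven_iff u

theorem L2ex_eq : L2ex d L =
    SetLike.coe (invariants (Sum.elim (fun i : Fin d => reflHom L {i}) (permHom L))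
      (Sum.rec (fun _ => reflHom_surjective _) (fun ζ => permHom_surjective ζ))) := by
  ext u
  rw [SetLike.mem_coe, mem_invariants, Sum.forall]
  exact and_congr (isCoordEven_iff u) (isPermInvariant_iff u)

theorem hasBranch_L2S {κ : ℝ} (hW : IsCoordEven W) (hA : StandingAssumption Φ W B) (hκ : 0 < κ)
    (hΦ : ContDiffAt ℝ 2 Φ (homInput Φ W B κ)) (hΦ' : deriv Φ (homInput Φ W B κ) ≠ 0)
    (hΦ'' : 0 ≤ deriv (deriv Φ) (homInput Φ W B κ)) (k : Fin d → ℕ)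
    (hk : ∀ l, ModeCondition Φ W B κ l ↔ l = k) :
    HasBranch Φ W B κ (L2S d L) (omega L k) := by
  rw [L2S_eq]
  refine hasBranch_invariants hW hA hκ hΦ hΦ' hΦ'' _ _ ((isCoordEven_iff W).1 hW) (omega L k)
    (fun i => pullback_toL2 _ _ _ (omega_reflHom k i)) ?_ (toL2_ne_zero (omega_zero_pos k)) ?_
  · rw [convOp_omega hW, smul_smul, (modeCondition_iff hA hκ hΦ' k).1 ((hk k).2 rfl), one_smul]
  · intro v hv hvk hkv
    refine eq_zero_of_inner_omega ((isCoordEven_iff v).2 hv) fun l => ?_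
    by_cases hl : l = k
    · rw [hl, real_inner_comm, hkv]
    · exact inner_omega_eq_zero hW hvk fun h =>
        hl ((hk l).1 ((modeCondition_iff hA hκ hΦ' l).2 h))

theorem hasBranch_L2ex {κ : ℝ} (hW : IsCoordEven W) (hA : StandingAssumption Φ W B) (hκ : 0 < κ)
    (hΦ : ContDiffAt ℝ 2 Φ (homInput Φ W B κ)) (hΦ' : deriv Φ (homInput Φ W B κ) ≠ 0)
    (hΦ'' : 0 ≤ deriv (deriv Φ) (homInput Φ W B κ)) (k : Fin d → ℕ)
    (hWp : IsPermInvariant W)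
    (hk : ∀ l, ModeCondition Φ W B κ l ↔ l ∈ permClass k) :
    HasBranch Φ W B κ (L2ex d L) (omegaSym L k) := by
  have hT : ∀ u : L2 d L, u ∈ L2ex d L ↔ u ∈ invariants
      (Sum.elim (fun i => reflHom L {i}) (permHom L))
      (Sum.rec (fun _ => reflHom_surjective _) (fun ζ => permHom_surjective ζ)) := fun u => by
    rw [L2ex_eq, SetLike.mem_coe]
  have hsum : toL2 (omegaSym L k) =
      (1 / √((permClass k).card : ℝ)) • ∑ l ∈ permClass k, toL2 (omega L l) := by
    simp only [← toL2_eq_toLp, omegaSym, map_smul, map_sum]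
  rw [L2ex_eq]
  refine hasBranch_invariants hW hA hκ hΦ hΦ' hΦ'' _ _ ((hT W).1 ⟨hW, hWp⟩) (omegaSym L k)
    ?_ ?_ (toL2_ne_zero (omegaSym_zero_pos k)) ?_
  · rintro (i | ζ)
    · exact pullback_toL2 _ _ _ (omegaSym_reflHom k i)
    · exact pullback_toL2 _ _ _ (omegaSym_permHom k ζ)
  · rw [hsum, map_smul, map_sum, smul_comm, Finset.smul_sum, omegaSym]
    congr 1
    refine Finset.sum_congr rfl fun l hl => ?_
    rw [convOp_omega hW, smul_smul, (modeCondition_iff hA hκ hΦ' l).1 ((hk l).2 hl), one_smul]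
  · intro v hv hvk hkv
    obtain ⟨hve, hvp⟩ := (hT v).2 hv
    -- All coefficients of `v` on the class of `k` are equal, so orthogonality to their normalised
    -- sum makes each of them vanish.
    have h0 : ⟪v, toL2 (omega L k)⟫_ℝ = 0 := by
      have hc := permClass_card_pos k
      rw [real_inner_comm, hsum, inner_smul_right, inner_sum, Finset.sum_congr rfl fun l hl =>
        inner_omega_of_mem_permClass hvp hl, Finset.sum_const, nsmul_eq_mul, ← mul_assoc] at hkv
      exact (mul_eq_zero.1 hkv).resolve_left (by positivity)
    refine eq_zero_of_inner_omega hve fun l => ?_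
    by_cases hl : l ∈ permClass k
    · rw [inner_omega_of_mem_permClass hvp hl, h0]
    · exact inner_omega_eq_zero hW hvk fun h =>
        hl ((hk l).1 ((modeCondition_iff hA hκ hΦ' l).2 h))

end Modes

end NeuralField

end

theorem mainTheorem1 (d : ℕ) (L : ℝ) [Fact (0 < L)] (Φ : ℝ → ℝ) (W : NeuralField.L2 d L) (B : ℝ)
    (hW : W ∈ NeuralField.L2S d L) (hA : NeuralField.StandingAssumption Φ W B) :
    -- the homogeneous stationary state is well defined
    (∀ κ > 0, ∃! r : ℝ,
      NeuralField.IsStationaryMean Φ W B (NeuralField.constL2 d L r) κ) ∧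
    ∀ κ : ℝ, 2 * |NeuralField.totalIntegral W| ^ 2 / (L ^ (2 * d) * Real.pi * B ^ 2) < κ →
      ContDiffAt ℝ 2 Φ (NeuralField.homInput Φ W B κ) →
      deriv Φ (NeuralField.homInput Φ W B κ) ≠ 0 →
      0 ≤ deriv (deriv Φ) (NeuralField.homInput Φ W B κ) →
      ∀ k : Fin d → ℕ,
        -- case (i)
        ((∀ l, NeuralField.ModeCondition Φ W B κ l ↔ l = k) →
          NeuralField.IsBifurcationPoint Φ W B κ ∧
          NeuralField.HasBranch Φ W B κ (NeuralField.L2S d L) (NeuralField.omega L k)) ∧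
        -- case (ii)
        (NeuralField.IsPermInvariant W →
          (∀ l, NeuralField.ModeCondition Φ W B κ l ↔ l ∈ NeuralField.permClass k) →
          NeuralField.IsBifurcationPoint Φ W B κ ∧
          NeuralField.HasBranch Φ W B κ (NeuralField.L2ex d L) (NeuralField.omegaSym L k)) := by
  refine ⟨fun κ hκ => NeuralField.existsUnique_isStationaryMean_constL2 hA hκ,
    fun κ hκ hΦ hΦ' hΦ'' k => ?_⟩
  have hL : 0 < L := Fact.out
  have hκ0 : 0 < κ := lt_of_le_of_lt (by positivity) hκ
  refine ⟨fun hk => ?_, fun hWp hk => ?_⟩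
  · have h := NeuralField.hasBranch_L2S hW hA hκ0 hΦ hΦ' hΦ'' k hk
    exact ⟨NeuralField.isBifurcationPoint_of_hasBranch subset_rfl h, h⟩
  · have h := NeuralField.hasBranch_L2ex hW hA hκ0 hΦ hΦ' hΦ'' k hWp hk
    exact ⟨NeuralField.isBifurcationPoint_of_hasBranch (fun u hu => hu.1) h, h⟩
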